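/- A modulus of continuity is a nondecreasing function $\omega:[0,1]\to[0,1]$ with $\omega(t)=0$ if and only if $t=0$ and $\lim_{t\to0+}\omega(t)=0$. Let $\mathbf G(3,2)$ be the Grassmannian of $2$-dimensional subspaces of $\mathbf R^3$; for a plane $S$ let $S_\natural$ be the orthogonal projection of $\mathbf R^3$ onto $S$, let $|\cdot|$ be the Hilbert–Schmidt norm on linear endomorphisms of $\mathbf R^3$, and let $T=\{z\in\mathbf R^3: z_3=0\}$. For a varifold $V$ (a Radon measure on $\mathbf R^3\times\mathbf G(3,2)$) let $\|V\|$ be its weight measure and $\|\delta V\|$ the total variation measure of its first variation. Let $\operatorname{Tan}^2(\|V\|,z)$ be the cone of $(\|V\|,2)$ approximate tangent vectors at $z$, and let $\tau(z)$ be the orthogonal projection onto $\operatorname{Tan}^2(\|V\|,z)$ at those points $z$ where this cone is a $2$-dimensional plane (hence at $\|V\|$ almost all $z$ if $V$ is integral). Theorem. Let $\omega$ be a modulus of continuity and $\varepsilon>0$. Then there exist a function $f:\mathbf R^2\to\mathbf R$, a $2$-dimensional integral varifold $V$ in $\mathbf R^3$, and a set $C\subset T$ such that $\operatorname{Lip}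 f\le\varepsilon$, $\|V\|$ is the restriction of the $2$-dimensional Hausdorff measure $\mathscr H^2$ to the graph $\{(x_1,x_2,f(x)):x\in\mathbf R^2\}$, $\|V\|(C)>0$, $\|\delta V\|(\mathbf R^3)<\infty$, $\|\delta V\|$ is absolutely continuous with respect to $\|V\|$, and for every $c\in C$ one has $\operatorname{Tan}^2(\|V\|,c)=T$, $$\limsup_{r\to0+}\; r^{-1}\,(\log(1/r))^{-1/2}\,\omega(r)^{-1}\left(\frac{1}{\|V\|(\mathbf B(c,r))}\int_{\mathbf B(c,r)\times\mathbf G(3,2)}|S_\natural-T_\natural|^2\,dV(z,S)\right)^{1/2}>0,$$ and $$\limsup_{r\to0+}\;\omega(r)^{-1}\,r^{-4}\,(\log(1/r))^{-1}\int_{\mathbf B(c,r)}|\tau(z)-\tau(c)|^2\,d\|V\|(z)>0,$$ where $\mathbf B(c,r)$ is the closed ball with centre $c$ and radius $r$. -/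

import Mathlib

open Set Filter Topology MeasureTheory
open scoped ENNReal NNReal

noncomputable section

namespace GMT

/-- Euclidean space `ℝⁿ`. -/
abbrev E (n : ℕ) : Type := EuclideanSpace ℝ (Fin n)

/-- A modulus of continuity: a nondecreasing function `ω : [0,1] → [0,1]` that vanishes exactly at
`0` and tends to `0` at `0`. Only the values of `ω` on `[0,1]` play a role. -/
structure IsModulusOfContinuity (ω : ℝ → ℝ) : Prop where
  mapsTo : MapsTo ω (Icc 0 1) (Icc 0 1)
  tendsto_zero : Tendsto ω (𝓝[>] 0) (𝓝 0)
  eq_zero_iff : ∀ t ∈ Icc (0 : ℝ) 1, ω t = 0 ↔ t = 0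
  monotoneOn : MonotoneOn ω (Icc 0 1)

/-- The squared Hilbert-Schmidt norm `|L|²= trace (L* ∘ L)` of an endomorphism of `ℝⁿ`. -/
def hsNormSq {n : ℕ} (L : E n →L[ℝ] E n) : ℝ :=
  ∑ i : Fin n, ‖L (EuclideanSpace.single i (1 : ℝ))‖ ^ 2

/-- The Grassmannian `G(n,m)` of `m` dimensional linear subspaces of `ℝⁿ`. -/
def Gr (n m : ℕ) : Type := {S : Submodule ℝ (E n) // Module.finrank ℝ S = m}

/-- The orthogonal projection of `ℝⁿ` onto a plane `S ∈ G(n,m)`. -/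
def Gr.proj {n m : ℕ} (S : Gr n m) : E n →L[ℝ] E n := S.1.starProjection

/-- Planes are close if and only if their orthogonal projections are. -/
instance (n m : ℕ) : TopologicalSpace (Gr n m) :=
  TopologicalSpace.induced Gr.proj inferInstance

instance (n m : ℕ) : MeasurableSpace (Gr n m) := borel _

instance (n m : ℕ) : BorelSpace (Gr n m) := ⟨rfl⟩

/-! ### Approximate tangent cones -/

/-- The closed cone `Tan^m(μ,a)` of `(μ,m)` approximate tangent vectors at `a`: the intersection
of the tangent cones `Tan(S,a)` (limits of `tₖ (xₖ - a)` with `xₖ ∈ S`, `xₖ → a`, `tₖ ≥ 0`) over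
all sets `S` whose complement has `m` dimensional `μ` density zero at `a`. -/
def approxTangentCone {n : ℕ} (m : ℕ) (μ : Measure (E n)) (a : E n) : Set (E n) :=
  {v | ∀ S : Set (E n),
    Tendsto (fun r : ℝ => μ (Metric.closedBall a r ∩ Sᶜ) / ENNReal.ofReal (r ^ m))
      (𝓝[>] 0) (𝓝 0) →
    v ∈ posTangentConeAt S a}

open Classical in
/-- The map `τ`: if `Tan^m(μ,z)` is an `m` dimensional plane, then `τ(z)` is the orthogonal
projection onto this plane. (At other points it is irrelevant and set to zero.) -/
def tangentProj {n : ℕ} (m : ℕ) (μ : Measure (E n)) (z : E n) : E n →L[ℝ] E n :=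
  if h : ∃ S : Gr n m, approxTangentCone m μ z = (S.1 : Set (E n)) then h.choose.proj else 0

/-! ### Varifolds -/

/-- An `m` dimensional varifold in `ℝⁿ`: a Radon measure on `ℝⁿ × G(n,m)`. -/
structure Varifold (n m : ℕ) where
  /-- The underlying measure. -/
  measure : Measure (E n × Gr n m)
  locallyFinite : IsLocallyFiniteMeasure measure

namespace Varifold

variable {n m : ℕ}

/-- The weight measure `‖V‖`. -/
def weight (V : Varifold n m) : Measure (E n) := V.measure.map Prod.fst

/-- The first variation `(δV)(θ) = ∫ trace (S ∘ Dθ(z)) dV(z,S)`, where `S` is identified with the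
orthogonal projection onto `S`; that is, the integral of the divergence of `θ` along `S`. -/
def firstVariation (V : Varifold n m) (θ : E n → E n) : ℝ :=
  ∫ p : E n × Gr n m,
    LinearMap.trace ℝ (E n) (p.2.proj.comp (fderiv ℝ θ p.1)).toLinearMap ∂V.measure

/-- The value of `‖δV‖` on an open set `U`: the supremum of `(δV)(θ)` over all smooth vector fields
`θ` with compact support in `U` and `|θ| ≤ 1`. -/
def variationOpen (V : Varifold n m) (U : Set (E n)) : ℝ≥0∞ :=
  ⨆ (θ : E n → E n) (_ : ContDiff ℝ (⊤ : ℕ∞) θ ∧ HasCompactSupport θ ∧ tsupport θ ⊆ U ∧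
    ∀ z, ‖θ z‖ ≤ 1), ENNReal.ofReal (V.firstVariation θ)

/-- The total variation measure `‖δV‖` of the first variation, on arbitrary sets. -/
def variation (V : Varifold n m) (A : Set (E n)) : ℝ≥0∞ :=
  ⨅ (U : Set (E n)) (_ : IsOpen U ∧ A ⊆ U), V.variationOpen U

end Varifold

/-- `M ⊆ ℝⁿ` is a Borel set with locally finite `m` dimensional Hausdorff measure that is covered,
up to a set of zero `m` dimensional Hausdorff measure, by countably many Lipschitz images
of `ℝᵐ`. -/
structure IsRectifiableSet {n : ℕ} (m : ℕ) (M : Set (E n)) : Prop where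
  measurableSet : MeasurableSet M
  finite_inter : ∀ K : Set (E n), IsCompact K →
    (Measure.euclideanHausdorffMeasure m : Measure (E n)) (M ∩ K) < ∞
  cover : ∃ g : ℕ → E m → E n, (∀ k, ∃ L : ℝ≥0, LipschitzWith L (g k)) ∧
    (Measure.euclideanHausdorffMeasure m : Measure (E n)) (M \ ⋃ k, range (g k)) = 0

/-- The measure of `A ⊆ ℝⁿ × G(n,m)` with respect to the varifold associated with a rectifiable
set `M`, namely `ℋᵐ {z ∈ M | (z, Tan^m(ℋᵐ ⌞ M, z)) ∈ A}`. -/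
def rectifiableValue {n m : ℕ} (M : Set (E n)) (A : Set (E n × Gr n m)) : ℝ≥0∞ :=
  (Measure.euclideanHausdorffMeasure m : Measure (E n))
    {z | z ∈ M ∧ ∃ S : Gr n m,
      approxTangentCone m ((Measure.euclideanHausdorffMeasure m).restrict M) z
        = (S.1 : Set (E n)) ∧ (z, S) ∈ A}

/-- Integral varifolds: countable sums of varifolds associated with rectifiable sets (positive
integer multiplicities are obtained by repeating sets, and finite sums by empty sets). -/
def Varifold.IsIntegral {n m : ℕ} (V : Varifold n m) : Prop :=
  ∃ M : ℕ → Set (E n), (∀ i, IsRectifiableSet m (M i)) ∧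
    ∀ A : Set (E n × Gr n m), MeasurableSet A → V.measure A = ∑' i, rectifiableValue (M i) A

/-! ### Graphs over the horizontal plane in three dimensional space -/

/-- The map `x ↦ (x₁, x₂, f(x))`, whose image is the graph of `f : ℝ² → ℝ`. -/
def graphMap (f : E 2 → ℝ) (x : E 2) : E 3 := !₂[x 0, x 1, f x]

/-- The horizontal plane `{z ∈ ℝ³ | z₃ = 0}`. -/
def horizontalPlane : Submodule ℝ (E 3) where
  carrier := {z | z 2 = 0}
  add_mem' {a b} ha hb := by
    have ha' : a 2 = 0 := ha
    have hb' : b 2 = 0 := hb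
    simp [ha', hb']
  zero_mem' := by simp
  smul_mem' c x hx := by
    have hx' : x 2 = 0 := hx
    simp [hx']

end GMT

end

/-! The construction rests on a logarithmic gap in dimension two. Let a radial bump have flux `m`,
and let its graph be a piece of a catenoid on an annulus with squared radii `2 * a` and `b`. Mean
curvature occurs only in the two transition layers, and its total is at most a constant times `m`,
whatever `a` and `b` are (`meanCurvature_bump`, `exists_lintegral_meanCurvature_bump_le`). The
Dirichlet energy is at least `m ^ 2 * log (b / (2 * a))` (`le_setLIntegral_norm_gradient_bump`). So
energy exceeds the square of curvature by a logarithm.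

The function `f` is a sum of such bumps, with disjoint supports, centred at the points of a sequence
of grids over the unit square. At the level with `R = 1 / n ^ 2` the mesh is `R / 4`, the flux is `R
^ 2 * √(ω R)`, `a = R ^ 4`, `b = R ^ 3 / 4`, and the disks have radius `ρ = 1 / n ^ 3`. There are
about `1 / R ^ 2` bumps, so a level costs total curvature of order `√(ω R)`, which is summable if
`n` grows fast. The slopes are at most `√(2 * ω R)`, and the disks cover area of order `R`. One bump
has energy at least `R ^ 4 * ω R * log (1 / R) / 2`.

A set of positive measure avoids all doubled disks (`volume_farSet_pos`), and `C` is the part of the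
graph over it. Around each of its points, at every level, the ball of radius `R` contains a whole
bump. Bumps meeting a disk of a coarser level are discarded to keep the supports disjoint, but the
growth of `n` ensures that none of those needed near `C` is lost (`active_of_near`). This gives both
lower bounds along the radii `R` (`limsup_pos`); the first also uses that balls have weight at most
`8 * R ^ 2` and that `ω ≤ 1`.

Since the Lipschitz constants of the bumps tend to zero, `f` is differentiable everywhere, with
gradient zero off the disks (`hasGradientAt_of_notMem`). Hence tangent planes exist at every point
of the graph and are horizontal on `C`. The area formula and the first variation are computed bump
by bump (`area_formula`, `hasSum_firstVariation`), and `‖δV‖` is dominated on open sets by a finite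
measure that is absolutely continuous with respect to the weight. -/

noncomputable section
namespace GMT

/-! ### Planes given by a slope -/

/-- The vector `(-g, 1)`, normal to the graph of the linear function with gradient `g`. -/
def normalVec (g : E 2) : E 3 := !₂[-g 0, -g 1, 1]

/-- The area factor `√(1 + |g|²)`. -/
def areaFactor (g : E 2) : ℝ := √(1 + ‖g‖ ^ 2)

lemma norm_sq_two (g : E 2) : ‖g‖ ^ 2 = g 0 ^ 2 + g 1 ^ 2 := by
  simp [EuclideanSpace.norm_sq_eq, Fin.sum_univ_two]

lemma norm_sq_three (g : E 3) : ‖g‖ ^ 2 = g 0 ^ 2 + g 1 ^ 2 + g 2 ^ 2 := by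
  simp [EuclideanSpace.norm_sq_eq, Fin.sum_univ_three]

lemma inner_two (v w : E 2) : inner ℝ v w = v 0 * w 0 + v 1 * w 1 := by
  simp [PiLp.inner_apply, Fin.sum_univ_two, mul_comm]

lemma inner_three (v w : E 3) : inner ℝ v w = v 0 * w 0 + v 1 * w 1 + v 2 * w 2 := by
  simp [PiLp.inner_apply, Fin.sum_univ_three, mul_comm]

@[simp] lemma areaFactor_zero : areaFactor 0 = 1 := by simp [areaFactor]

lemma areaFactor_sq (g : E 2) : areaFactor g ^ 2 = 1 + g 0 ^ 2 + g 1 ^ 2 := by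
  rw [areaFactor, Real.sq_sqrt (by positivity), norm_sq_two]; ring

lemma one_le_areaFactor (g : E 2) : 1 ≤ areaFactor g := by
  rw [areaFactor, Real.one_le_sqrt]; nlinarith [sq_nonneg ‖g‖]

lemma areaFactor_pos (g : E 2) : 0 < areaFactor g := zero_lt_one.trans_le (one_le_areaFactor g)

lemma areaFactor_le (g : E 2) : areaFactor g ≤ 1 + ‖g‖ := by
  rw [areaFactor, Real.sqrt_le_left (by positivity)]; nlinarith [norm_nonneg g]

lemma continuous_areaFactor : Continuous areaFactor := by
  unfold areaFactor; fun_prop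

lemma normalVec_norm_sq (g : E 2) : ‖normalVec g‖ ^ 2 = areaFactor g ^ 2 := by
  rw [norm_sq_three, areaFactor_sq]; simp [normalVec]; ring

lemma normalVec_ne_zero (g : E 2) : normalVec g ≠ 0 := by
  intro h
  have := congrArg (fun v : E 3 => v 2) h
  simp [normalVec] at this

lemma continuous_normalVec : Continuous normalVec := by
  unfold normalVec
  refine (PiLp.continuous_toLp 2 _).comp (continuous_pi fun i => ?_)
  fin_cases i <;> simp <;> fun_prop

/-- The tangent plane of the graph of a function with gradient `g`. -/
def tangentPlane (g : E 2) : Gr 3 2 :=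
  ⟨(ℝ ∙ normalVec g)ᗮ, by
    have : Fact (Module.finrank ℝ (E 3) = 2 + 1) := ⟨by simp⟩
    exact Submodule.finrank_orthogonal_span_singleton (normalVec_ne_zero g)⟩

lemma mem_tangentPlane {g : E 2} {v : E 3} :
    v ∈ (tangentPlane g).1 ↔ v 2 = g 0 * v 0 + g 1 * v 1 := by
  rw [tangentPlane, Submodule.mem_orthogonal_singleton_iff_inner_right, inner_three]
  simp only [normalVec, PiLp.toLp_apply, Matrix.cons_val]
  constructor <;> intro h <;> linarith

lemma tangentPlane_zero : (tangentPlane 0).1 = horizontalPlane := by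
  ext v
  rw [mem_tangentPlane]
  simp only [PiLp.zero_apply, zero_mul, add_zero]
  rfl

lemma tangentPlane_proj (g : E 2) (v : E 3) :
    (tangentPlane g).proj v =
      v - (inner ℝ (normalVec g) v / areaFactor g ^ 2) • normalVec g := by
  rw [Gr.proj, tangentPlane, Submodule.starProjection_orthogonal', ← normalVec_norm_sq]
  simp [Submodule.starProjection_singleton]

lemma tangentPlane_proj_eq (g : E 2) :
    (tangentPlane g).proj = ContinuousLinearMap.id ℝ (E 3) -
      ((areaFactor g ^ 2)⁻¹ • innerSL ℝ (normalVec g)).smulRight (normalVec g) := by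
  ext1 v
  rw [tangentPlane_proj]
  simp [div_eq_inv_mul]

lemma continuous_tangentPlane : Continuous tangentPlane := by
  rw [continuous_induced_rng]
  have : Gr.proj ∘ tangentPlane = fun g => ContinuousLinearMap.id ℝ (E 3) -
      ((areaFactor g ^ 2)⁻¹ • innerSL ℝ (normalVec g)).smulRight (normalVec g) :=
    funext tangentPlane_proj_eq
  rw [this]
  have h1 : Continuous fun g => ((areaFactor g ^ 2)⁻¹ • innerSL ℝ (normalVec g)) :=
    ((continuous_areaFactor.pow 2).inv₀ fun g => (pow_pos (areaFactor_pos g) 2).ne').smul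
      ((innerSL ℝ).continuous.comp continuous_normalVec)
  refine continuous_const.sub ?_
  exact (ContinuousLinearMap.smulRightL ℝ (E 3) (E 3)).continuous₂.comp
    (h1.prodMk continuous_normalVec)

lemma continuous_proj {n m : ℕ} : Continuous (Gr.proj : Gr n m → _) := continuous_induced_dom

lemma continuous_hsNormSq {n : ℕ} : Continuous (hsNormSq : (E n →L[ℝ] E n) → ℝ) := by
  unfold hsNormSq; fun_prop

/-- The divergence along the tangent plane, multiplied with the area factor, as a linear
combination of the derivatives of the vector field along the graph. -/
lemma areaFactor_mul_trace (g : E 2) (L : E 3 →L[ℝ] E 3) :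
    areaFactor g * LinearMap.trace ℝ (E 3) ((tangentPlane g).proj.comp L).toLinearMap =
      (areaFactor g - g 0 * (g 0 / areaFactor g)) * L !₂[1, 0, g 0] 0
      - g 1 * (g 0 / areaFactor g) * L !₂[1, 0, g 0] 1
      + g 0 / areaFactor g * L !₂[1, 0, g 0] 2
      - g 0 * (g 1 / areaFactor g) * L !₂[0, 1, g 1] 0
      + (areaFactor g - g 1 * (g 1 / areaFactor g)) * L !₂[0, 1, g 1] 1
      + g 1 / areaFactor g * L !₂[0, 1, g 1] 2 := by
  have h0 : (!₂[1, 0, g 0] : E 3) = EuclideanSpace.single 0 (1 : ℝ) +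
      g 0 • EuclideanSpace.single 2 (1 : ℝ) := by
    ext i; fin_cases i <;> simp
  have h1 : (!₂[0, 1, g 1] : E 3) = EuclideanSpace.single 1 (1 : ℝ) +
      g 1 • EuclideanSpace.single 2 (1 : ℝ) := by
    ext i; fin_cases i <;> simp
  have hW := areaFactor_sq g
  have hW0 := (areaFactor_pos g).ne'
  rw [LinearMap.trace_eq_sum_inner _ (EuclideanSpace.basisFun (Fin 3) ℝ), h0, h1]
  simp only [Fin.sum_univ_three, EuclideanSpace.basisFun_apply, ContinuousLinearMap.coe_coe,
    ContinuousLinearMap.comp_apply, tangentPlane_proj, map_add, map_smul, inner_three, normalVec,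
    PiLp.add_apply, PiLp.smul_apply, PiLp.sub_apply, Matrix.cons_val, smul_eq_mul,
    PiLp.single_apply]
  simp
  field_simp
  simp only [hW]
  ring

/-- The tilt of a plane with respect to the horizontal one controls the slope. -/
lemma le_hsNormSq_tangentPlane_sub (g : E 2) :
    ‖g‖ ^ 2 / (1 + ‖g‖ ^ 2) ≤
      hsNormSq ((tangentPlane g).proj - horizontalPlane.starProjection) := by
  have hp : horizontalPlane.starProjection = (tangentPlane 0).proj := by
    simp only [Gr.proj, tangentPlane_zero]
  -- The vertical basis vector alone gives the bound: the horizontal projection kills it.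
  have h2 : ‖((tangentPlane g).proj - horizontalPlane.starProjection)
      (EuclideanSpace.single 2 1)‖ ^ 2 = ‖g‖ ^ 2 / (1 + ‖g‖ ^ 2) := by
    have hW := areaFactor_sq g
    have hW0 := (areaFactor_pos g).ne'
    have : 1 + ‖g‖ ^ 2 = areaFactor g ^ 2 := by rw [hW, norm_sq_two]; ring
    rw [this, hp, norm_sq_three, norm_sq_two]
    simp [tangentPlane_proj, inner_three, normalVec]
    field_simp
    rw [show g 1 ^ 2 = areaFactor g ^ 2 - 1 - g 0 ^ 2 by linarith]
    ring
  rw [← h2, hsNormSq, Fin.sum_univ_three]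
  have := sq_nonneg ‖((tangentPlane g).proj - horizontalPlane.starProjection)
      (EuclideanSpace.single 0 1)‖
  have := sq_nonneg ‖((tangentPlane g).proj - horizontalPlane.starProjection)
      (EuclideanSpace.single 1 1)‖
  linarith

/-! ### Graphs -/

/-- The orthogonal projection `ℝ³ → ℝ²` forgetting the last coordinate. -/
def baseProj : E 3 →L[ℝ] E 2 :=
  LinearMap.toContinuousLinearMap
    { toFun := fun z => !₂[z 0, z 1]
      map_add' := fun z w => by ext i; fin_cases i <;> simp
      map_smul' := fun c z => by ext i; fin_cases i <;> simp }

@[simp] lemma baseProj_zero (z : E 3) : baseProj z 0 = z 0 := rfl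

@[simp] lemma baseProj_one (z : E 3) : baseProj z 1 = z 1 := rfl

@[simp] lemma baseProj_graphMap (f : E 2 → ℝ) (x : E 2) : baseProj (graphMap f x) = x := by
  ext i; fin_cases i <;> simp [graphMap]

@[simp] lemma graphMap_zero (f : E 2 → ℝ) (x : E 2) : graphMap f x 0 = x 0 := rfl

@[simp] lemma graphMap_one (f : E 2 → ℝ) (x : E 2) : graphMap f x 1 = x 1 := rfl

@[simp] lemma graphMap_two (f : E 2 → ℝ) (x : E 2) : graphMap f x 2 = f x := rfl

lemma norm_baseProj_le (z : E 3) : ‖baseProj z‖ ≤ ‖z‖ := by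
  rw [← sq_le_sq₀ (norm_nonneg _) (norm_nonneg _), norm_sq_two, norm_sq_three]
  simp only [baseProj_zero, baseProj_one]
  nlinarith [sq_nonneg (z 2)]

lemma lipschitzWith_baseProj : LipschitzWith 1 baseProj :=
  LipschitzWith.of_dist_le_mul fun z w => by
    rw [dist_eq_norm, dist_eq_norm, ← map_sub, NNReal.coe_one, one_mul]
    exact norm_baseProj_le _

lemma norm_graphMap_sub_sq (f : E 2 → ℝ) (x y : E 2) :
    ‖graphMap f x - graphMap f y‖ ^ 2 = ‖x - y‖ ^ 2 + (f x - f y) ^ 2 := by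
  simp [norm_sq_two, norm_sq_three]

lemma norm_graphMap_sub_le (f : E 2 → ℝ) (x y : E 2) :
    ‖graphMap f x - graphMap f y‖ ≤ ‖x - y‖ + |f x - f y| := by
  rw [← sq_le_sq₀ (norm_nonneg _) (by positivity), norm_graphMap_sub_sq]
  nlinarith [sq_abs (f x - f y), mul_nonneg (norm_nonneg (x - y)) (abs_nonneg (f x - f y))]

lemma lipschitzWith_graphMap {f : E 2 → ℝ} {K : ℝ≥0} (hf : LipschitzWith K f) :
    LipschitzWith (1 + K) (graphMap f) :=
  LipschitzWith.of_dist_le_mul fun x y => by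
    have h1 := hf.dist_le_mul x y
    have h2 := norm_graphMap_sub_le f x y
    rw [Real.dist_eq] at h1
    rw [dist_eq_norm] at h1 ⊢
    rw [dist_eq_norm]
    push_cast
    linarith

lemma continuous_graphMap {f : E 2 → ℝ} (hf : Continuous f) : Continuous (graphMap f) := by
  unfold graphMap
  refine (PiLp.continuous_toLp 2 _).comp (continuous_pi fun i => ?_)
  fin_cases i <;> simp <;> fun_prop

lemma leftInverse_graphMap (f : E 2 → ℝ) : Function.LeftInverse baseProj (graphMap f) :=
  baseProj_graphMap f

lemma injective_graphMap (f : E 2 → ℝ) : Function.Injective (graphMap f) :=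
  (leftInverse_graphMap f).injective

lemma isClosedEmbedding_graphMap {f : E 2 → ℝ} (hf : Continuous f) :
    IsClosedEmbedding (graphMap f) :=
  (leftInverse_graphMap f).isClosedEmbedding baseProj.continuous (continuous_graphMap hf)

lemma measurableEmbedding_graphMap {f : E 2 → ℝ} (hf : Continuous f) :
    MeasurableEmbedding (graphMap f) :=
  (isClosedEmbedding_graphMap hf).measurableEmbedding

/-- The derivative of the graph map of a function with gradient `g`. -/
def graphDeriv (g : E 2) : E 2 →L[ℝ] E 3 :=
  LinearMap.toContinuousLinearMap
    { toFun := fun w => !₂[w 0, w 1, inner ℝ g w]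
      map_add' := fun z w => by ext i; fin_cases i <;> simp [inner_add_right]
      map_smul' := fun c z => by ext i; fin_cases i <;> simp [inner_smul_right] }

lemma graphDeriv_apply (g w : E 2) : graphDeriv g w = !₂[w 0, w 1, inner ℝ g w] := rfl

lemma hasFDerivAt_graphMap {f : E 2 → ℝ} {g x : E 2} (hf : HasGradientAt f g x) :
    HasFDerivAt (graphMap f) (graphDeriv g) x := by
  rw [← hasFDerivWithinAt_univ, hasFDerivWithinAt_euclidean]
  intro i
  rw [hasFDerivWithinAt_univ]
  fin_cases i
  · exact (PiLp.proj 2 (fun _ : Fin 2 => ℝ) (𝕜 := ℝ) 0).hasFDerivAt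
  · exact (PiLp.proj 2 (fun _ : Fin 2 => ℝ) (𝕜 := ℝ) 1).hasFDerivAt
  · exact hasGradientAt_iff_hasFDerivAt.1 hf

lemma graphDeriv_baseProj {g : E 2} {v : E 3} (hv : v ∈ (tangentPlane g).1) :
    graphDeriv g (baseProj v) = v := by
  rw [mem_tangentPlane] at hv
  ext i
  fin_cases i
  · rfl
  · rfl
  · simp [graphDeriv_apply, inner_two, hv]

/-- The two dimensional Hausdorff measure of a set is at least that of its projection. -/
lemma volume_le_euclideanHausdorffMeasure_graphMap_image (f : E 2 → ℝ) (B : Set (E 2)) :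
    volume B ≤ (Measure.euclideanHausdorffMeasure 2 : Measure (E 3)) (graphMap f '' B) := by
  have h := lipschitzWith_baseProj.hausdorffMeasure_image_le (d := 2) (by norm_num)
    (graphMap f '' B)
  rw [← EuclideanSpace.euclideanHausdorffMeasure_eq_volume 2]
  simp only [Measure.euclideanHausdorffMeasure_def, Measure.smul_apply, Nat.cast_ofNat]
  rw [image_image] at h
  simp only [baseProj_graphMap, image_id'] at h
  simp only [ENNReal.coe_one, ENNReal.one_rpow, one_mul] at h
  gcongr

/-- The graph lies in the zero set of `z 2 - f (baseProj z)`. This function is therefore both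
maximal and minimal on the graph at every point of it, so its derivative vanishes on tangent
vectors. -/
lemma posTangentConeAt_graph_subset {f : E 2 → ℝ} {g x : E 2} (hf : HasGradientAt f g x) :
    posTangentConeAt (range (graphMap f)) (graphMap f x) ⊆ (tangentPlane g).1 := by
  intro v hv
  let Φ : E 3 → ℝ := fun z => z 2 - f (baseProj z)
  have hΦ : HasFDerivAt Φ ((PiLp.proj 2 (fun _ : Fin 3 => ℝ) (𝕜 := ℝ) 2) -
      (InnerProductSpace.toDual ℝ (E 2) g).comp baseProj) (graphMap f x) := by
    refine ((PiLp.proj 2 (fun _ : Fin 3 => ℝ) (𝕜 := ℝ) 2).hasFDerivAt).sub ?_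
    refine HasFDerivAt.comp (graphMap f x) (g := f) ?_ baseProj.hasFDerivAt
    rw [baseProj_graphMap]
    exact hasGradientAt_iff_hasFDerivAt.1 hf
  have h0 : ∀ z ∈ range (graphMap f), Φ z = 0 := by
    rintro _ ⟨y, rfl⟩
    simp [Φ]
  have hx := h0 _ (mem_range_self x)
  have hmax : IsLocalMaxOn Φ (range (graphMap f)) (graphMap f x) := by
    filter_upwards [self_mem_nhdsWithin] with z hz
    rw [hx, h0 z hz]
  have hmin : IsLocalMinOn Φ (range (graphMap f)) (graphMap f x) := by
    filter_upwards [self_mem_nhdsWithin] with z hz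
    rw [hx, h0 z hz]
  have h1 := hmax.hasFDerivWithinAt_nonpos hΦ.hasFDerivWithinAt hv
  have h2 := hmin.hasFDerivWithinAt_nonneg hΦ.hasFDerivWithinAt hv
  have h3 := le_antisymm h1 h2
  simp [inner_two] at h3
  rw [SetLike.mem_coe, mem_tangentPlane]
  linarith

/-- If `S` missed the graph over a ball of radius `η * t` about `x + t • w`, then the complement of
`S` would have measure at least a fixed multiple of `t ^ 2` in the ball of radius `R * t`, against
density zero. The threshold `c` is the ratio of the two quantities. -/
lemma eventually_exists_mem_of_density {f : E 2 → ℝ} {K : ℝ≥0} (hf : LipschitzWith K f) (x w : E 2)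
    {S : Set (E 3)}
    (hS : Tendsto (fun r : ℝ =>
      ((Measure.euclideanHausdorffMeasure 2 : Measure (E 3)).restrict (range (graphMap f)))
        (Metric.closedBall (graphMap f x) r ∩ Sᶜ) / ENNReal.ofReal (r ^ 2)) (𝓝[>] 0) (𝓝 0))
    {η : ℝ} (hη : 0 < η) :
    ∀ᶠ t : ℝ in 𝓝[>] 0, ∃ y ∈ Metric.ball (x + t • w) (η * t), graphMap f y ∈ S := by
  set R : ℝ := (1 + K) * (‖w‖ + η) with hR
  have hR0 : 0 < R := by positivity
  set c : ℝ≥0∞ := volume (Metric.ball (0 : E 2) η) / ENNReal.ofReal (R ^ 2) with hc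
  have hc0 : 0 < c := by
    rw [hc]
    exact ENNReal.div_pos (Metric.measure_ball_pos _ _ hη).ne' ENNReal.ofReal_ne_top
  have hlim : Tendsto (fun t : ℝ => R * t) (𝓝[>] 0) (𝓝[>] 0) := by
    refine tendsto_nhdsWithin_iff.2 ⟨?_, ?_⟩
    · have : Tendsto (fun t : ℝ => R * t) (𝓝 0) (𝓝 (R * 0)) := tendsto_id.const_mul R
      rw [mul_zero] at this
      exact this.mono_left nhdsWithin_le_nhds
    · filter_upwards [self_mem_nhdsWithin] with t ht
      exact mul_pos hR0 ht
  filter_upwards [(hS.comp hlim).eventually (gt_mem_nhds hc0), self_mem_nhdsWithin] with t ht ht0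
  have ht0 : 0 < t := ht0
  by_contra! hcon
  refine absurd ht (not_lt.2 ?_)
  have hsub : graphMap f '' Metric.ball (x + t • w) (η * t) ⊆
      (Metric.closedBall (graphMap f x) (R * t) ∩ Sᶜ) ∩ range (graphMap f) := by
    rintro _ ⟨y, hy, rfl⟩
    refine ⟨⟨?_, hcon y hy⟩, mem_range_self y⟩
    rw [Metric.mem_closedBall]
    refine ((lipschitzWith_graphMap hf).dist_le_mul y x).trans ?_
    have h1 : dist y x ≤ (‖w‖ + η) * t := by
      have h2 := dist_triangle y (x + t • w) x
      rw [Metric.mem_ball] at hy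
      have h3 : dist (x + t • w) x = t * ‖w‖ := by
        rw [dist_eq_norm, add_sub_cancel_left, norm_smul, Real.norm_of_nonneg ht0.le]
      nlinarith
    calc _ ≤ ((1 + K : ℝ≥0) : ℝ) * ((‖w‖ + η) * t) := by gcongr
      _ = R * t := by rw [hR]; push_cast; ring
  have hvol : volume (Metric.ball (x + t • w) (η * t)) =
      ENNReal.ofReal (t ^ 2) * volume (Metric.ball (0 : E 2) η) := by
    rw [mul_comm η t, Measure.addHaar_ball_mul_of_pos _ _ ht0]
    simp
  simp only [Function.comp]
  calc c = ENNReal.ofReal (t ^ 2) * volume (Metric.ball (0 : E 2) η) /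
        ENNReal.ofReal ((R * t) ^ 2) := by
        rw [hc, mul_pow R t, mul_comm (R ^ 2), ENNReal.ofReal_mul (by positivity),
          ENNReal.mul_div_mul_left _ _ (by simp [ht0.ne']) ENNReal.ofReal_ne_top]
    _ ≤ _ := by
        rw [← hvol]
        gcongr
        exact (volume_le_euclideanHausdorffMeasure_graphMap_image f _).trans
          ((measure_mono hsub).trans (Measure.le_restrict_apply _ _))

/-- The approximate tangent cone of a Lipschitz graph at a point of differentiability. -/
lemma approxTangentCone_graph {f : E 2 → ℝ} {K : ℝ≥0} (hf : LipschitzWith K f) {g x : E 2}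
    (hg : HasGradientAt f g x) :
    approxTangentCone 2
      ((Measure.euclideanHausdorffMeasure 2 : Measure (E 3)).restrict (range (graphMap f)))
      (graphMap f x) = (tangentPlane g).1 := by
  refine Subset.antisymm (fun v hv => ?_) (fun v hv => ?_)
  · refine posTangentConeAt_graph_subset hg (hv (range (graphMap f)) ?_)
    have hm := (isClosedEmbedding_graphMap hf.continuous).isClosed_range.measurableSet
    have : ∀ r, ((Measure.euclideanHausdorffMeasure 2 : Measure (E 3)).restrict
        (range (graphMap f))) (Metric.closedBall (graphMap f x) r ∩ (range (graphMap f))ᶜ) = 0 := by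
      intro r
      rw [Measure.restrict_apply' hm, inter_assoc, compl_inter_self, inter_empty, measure_empty]
    simp [this]
  · intro S hS
    set w := baseProj v with hw
    -- Points of `S` are found over `y n` with `y n = x + t n • w + o(t n)`. The difference
    -- quotients of the graph map along them converge to `graphDeriv g w = v`.
    have hex : ∀ n : ℕ, ∃ t : ℝ, 0 < t ∧ t < 1 / ((n : ℝ) + 1) ∧
        ∃ y ∈ Metric.ball (x + t • w) (1 / ((n : ℝ) + 1) * t), graphMap f y ∈ S := by
      intro n
      have hn : (0 : ℝ) < 1 / ((n : ℝ) + 1) := by positivity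
      have h1 := eventually_exists_mem_of_density hf x w hS hn
      have h2 : ∀ᶠ t : ℝ in 𝓝[>] 0, t < 1 / ((n : ℝ) + 1) :=
        nhdsWithin_le_nhds (gt_mem_nhds hn)
      obtain ⟨t, h3, h4, h5⟩ :=
        (h1.and (h2.and (self_mem_nhdsWithin : ∀ᶠ t : ℝ in 𝓝[>] 0, t ∈ Ioi (0 : ℝ)))).exists
      exact ⟨t, h5, h4, h3⟩
    choose t ht0 ht1 y hy hyS using hex
    have hone := tendsto_one_div_add_atTop_nhds_zero_nat (𝕜 := ℝ)
    have ht : Tendsto t atTop (𝓝 0) :=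
      squeeze_zero (fun n => (ht0 n).le) (fun n => (ht1 n).le) hone
    have hy1 : Tendsto (fun n => (t n)⁻¹ • (y n - x)) atTop (𝓝 w) := by
      rw [tendsto_iff_norm_sub_tendsto_zero]
      refine squeeze_zero (fun n => norm_nonneg _) (fun n => ?_) hone
      have h1 := hy n
      rw [Metric.mem_ball, dist_eq_norm] at h1
      have h2 : (t n)⁻¹ • (y n - x) - w = (t n)⁻¹ • (y n - (x + t n • w)) := by
        rw [← sub_sub, smul_sub _ (y n - x), inv_smul_smul₀ (ht0 n).ne']
      rw [h2, norm_smul, norm_inv, Real.norm_of_nonneg (ht0 n).le, inv_mul_le_iff₀ (ht0 n)]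
      linarith
    have hy0 : Tendsto (fun n => y n - x) atTop (𝓝 0) := by
      have := ht.smul hy1
      rw [zero_smul] at this
      exact this.congr fun n => by rw [smul_inv_smul₀ (ht0 n).ne']
    have hF := (hasFDerivAt_graphMap hg).hasFDerivWithinAt (s := univ) |>.lim
      hy0 (Eventually.of_forall fun _ => mem_univ _) hy1
    rw [hw, graphDeriv_baseProj hv] at hF
    simp only [add_sub_cancel] at hF
    refine mem_tangentConeAt_of_seq atTop (fun n => (Real.toNNReal (t n)⁻¹))
      (fun n => graphMap f (y n) - graphMap f x) ?_ ?_ ?_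
    · have := (continuous_graphMap hf.continuous).continuousAt (x := x) |>.tendsto.comp
        (tendsto_sub_nhds_zero_iff.1 hy0)
      exact tendsto_sub_nhds_zero_iff.2 this
    · exact Eventually.of_forall fun n => by simpa using hyS n
    · refine hF.congr fun n => ?_
      rw [NNReal.smul_def, Real.coe_toNNReal _ (inv_nonneg.2 (ht0 n).le)]

/-! ### The area formula for graphs -/

/-- Points of `B` identified by `φ` are identified by `ψ`, so `ψ` factors through `φ` on `B` by a
`K`-Lipschitz map; neither map need be injective. -/
lemma hausdorffMeasure_image_le_of_dist_le {X Y Z : Type*} [PseudoMetricSpace X] [MetricSpace Y]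
    [MetricSpace Z] [MeasurableSpace Y] [BorelSpace Y] [MeasurableSpace Z] [BorelSpace Z]
    {φ : X → Y} {ψ : X → Z} {B : Set X} {K : ℝ≥0} {d : ℝ} (hd : 0 ≤ d)
    (h : ∀ x ∈ B, ∀ y ∈ B, dist (ψ x) (ψ y) ≤ K * dist (φ x) (φ y)) :
    μH[d] (ψ '' B) ≤ (K : ℝ≥0∞) ^ d * μH[d] (φ '' B) := by
  rcases B.eq_empty_or_nonempty with rfl | ⟨b, hb⟩
  · simp
  have : Nonempty X := ⟨b⟩
  set s := Function.invFunOn φ B with hs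
  have hs1 : ∀ x ∈ B, s (φ x) ∈ B := fun x hx => Function.invFunOn_mem ⟨x, hx, rfl⟩
  have hs2 : ∀ x ∈ B, φ (s (φ x)) = φ x := fun x hx => Function.invFunOn_eq ⟨x, hx, rfl⟩
  have hs3 : ∀ x ∈ B, ψ (s (φ x)) = ψ x := by
    intro x hx
    have := h _ (hs1 x hx) x hx
    rw [hs2 x hx, dist_self, mul_zero] at this
    exact dist_le_zero.1 this
  have himg : (ψ ∘ s) '' (φ '' B) = ψ '' B := by
    rw [image_image]
    exact image_congr hs3
  rw [← himg]
  refine LipschitzOnWith.hausdorffMeasure_image_le (LipschitzOnWith.of_dist_le_mul ?_) hd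
  rintro _ ⟨x, hx, rfl⟩ _ ⟨y, hy, rfl⟩
  simp only [Function.comp]
  rw [hs3 x hx, hs3 y hy]
  exact h x hx y hy

lemma euclideanHausdorffMeasure_image_le_of_dist_le {X Y Z : Type*} [PseudoMetricSpace X]
    [MetricSpace Y] [MetricSpace Z] [MeasurableSpace Y] [BorelSpace Y] [MeasurableSpace Z]
    [BorelSpace Z] {φ : X → Y} {ψ : X → Z} {B : Set X} {K : ℝ≥0} (d : ℕ)
    (h : ∀ x ∈ B, ∀ y ∈ B, dist (ψ x) (ψ y) ≤ K * dist (φ x) (φ y)) :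
    (Measure.euclideanHausdorffMeasure d : Measure Z) (ψ '' B) ≤
      (K : ℝ≥0∞) ^ d * (Measure.euclideanHausdorffMeasure d : Measure Y) (φ '' B) := by
  simp only [Measure.euclideanHausdorffMeasure_def, Measure.smul_apply]
  rw [mul_smul_comm]
  have := hausdorffMeasure_image_le_of_dist_le (d := d) (by positivity) h
  rw [ENNReal.rpow_natCast] at this
  gcongr

/-- The linear endomorphism of `ℝ²` with `|M v|² = |v|² + ⟨g, v⟩²` stretching in direction `g`. -/
def stretch (g : E 2) : E 2 →L[ℝ] E 2 :=
  ContinuousLinearMap.id ℝ (E 2) + ((1 + areaFactor g)⁻¹ • innerSL ℝ g).smulRight g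

lemma stretch_apply (g v : E 2) : stretch g v = v + (inner ℝ g v / (1 + areaFactor g)) • g := by
  simp [stretch, div_eq_inv_mul]

/-- Because of this identity, `stretch g` is a planar model of the derivative of the graph map, and
planar Lebesgue measure can replace Hausdorff measure on the tangent plane. The coefficient `1 / (1
+ areaFactor g)` works since `‖g‖ ^ 2 = areaFactor g ^ 2 - 1`. -/
lemma norm_stretch (g v : E 2) : ‖stretch g v‖ = ‖graphDeriv g v‖ := by
  rw [← sq_eq_sq₀ (norm_nonneg _) (norm_nonneg _), norm_sq_two, norm_sq_three]
  have hW := areaFactor_sq g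
  have hW0 : 1 + areaFactor g ≠ 0 := by linarith [areaFactor_pos g]
  simp [stretch_apply, graphDeriv_apply, inner_two]
  field_simp
  linear_combination (-(g 0 * v 0 + g 1 * v 1) ^ 2) * hW

lemma norm_le_norm_stretch (g v : E 2) : ‖v‖ ≤ ‖stretch g v‖ := by
  have h : baseProj (graphDeriv g v) = v := by ext i; fin_cases i <;> rfl
  rw [norm_stretch]
  simpa only [h] using norm_baseProj_le (graphDeriv g v)

lemma det_stretch (g : E 2) : LinearMap.det (stretch g : E 2 →ₗ[ℝ] E 2) = areaFactor g := by
  have hW := areaFactor_sq g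
  have hW0 : 1 + areaFactor g ≠ 0 := by linarith [areaFactor_pos g]
  rw [← LinearMap.det_toMatrix (EuclideanSpace.basisFun (Fin 2) ℝ).toBasis, Matrix.det_fin_two]
  simp [LinearMap.toMatrix_apply, stretch_apply, inner_two]
  field_simp
  linear_combination (-(1 + areaFactor g)) * hW

lemma volume_stretch_image (g : E 2) (B : Set (E 2)) :
    volume (stretch g '' B) = ENNReal.ofReal (areaFactor g) * volume B := by
  rw [Measure.addHaar_image_continuousLinearMap, det_stretch, abs_of_pos (areaFactor_pos g)]

lemma continuous_gradient {u : E 2 → ℝ} (hu : ContDiff ℝ 1 u) : Continuous (gradient u) :=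
  (InnerProductSpace.toDual ℝ (E 2)).symm.continuous.comp (hu.continuous_fderiv one_ne_zero)

lemma hasStrictFDerivAt_graphMap {u : E 2 → ℝ} (hu : ContDiff ℝ 1 u) (x : E 2) :
    HasStrictFDerivAt (graphMap u) (graphDeriv (gradient u x)) x := by
  have h : ContDiff ℝ 1 (graphMap u) := by
    rw [contDiff_euclidean]
    intro i
    fin_cases i
    · exact (PiLp.proj 2 (fun _ : Fin 2 => ℝ) (𝕜 := ℝ) 0).contDiff
    · exact (PiLp.proj 2 (fun _ : Fin 2 => ℝ) (𝕜 := ℝ) 1).contDiff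
    · exact hu
  exact h.contDiffAt.hasStrictFDerivAt'
    (hasFDerivAt_graphMap (hu.differentiable one_ne_zero x).hasGradientAt) one_ne_zero

/-- By strict differentiability, distances under the graph map and under `stretch g` agree near `x₀`
up to the factor `K`. Two powers of `K` come from two-dimensional measure, the third from the
oscillation of the area factor. -/
lemma exists_nhds_comparison {u : E 2 → ℝ} (hu : ContDiff ℝ 1 u) (x₀ : E 2) {K : ℝ≥0}
    (hK : 1 < K) : ∃ U ∈ 𝓝 x₀, ∀ B ⊆ U, MeasurableSet B →
      (Measure.euclideanHausdorffMeasure 2 : Measure (E 3)) (graphMap u '' B) ≤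
        (K : ℝ≥0∞) ^ 3 * ∫⁻ x in B, ENNReal.ofReal (areaFactor (gradient u x)) ∧
      ∫⁻ x in B, ENNReal.ofReal (areaFactor (gradient u x)) ≤ (K : ℝ≥0∞) ^ 3 *
        (Measure.euclideanHausdorffMeasure 2 : Measure (E 3)) (graphMap u '' B) := by
  have hK' : (1 : ℝ) < K := hK
  have hK0 : (0 : ℝ) < K := zero_lt_one.trans hK'
  set g := gradient u x₀ with hg
  have hstrict := hasStrictFDerivAt_graphMap hu x₀
  have hδ : 0 < 1 - (K : ℝ)⁻¹ := sub_pos.2 (inv_lt_one_of_one_lt₀ hK')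
  -- The error `1 - K⁻¹` leaves exactly the factor `K⁻¹` in the lower bound, and gives `2 - K⁻¹ ≤ K`
  -- in the upper one.
  obtain ⟨U, hU, hUF⟩ := hstrict.approximates_deriv_on_nhds (c := ⟨1 - (K : ℝ)⁻¹, hδ.le⟩)
    (Or.inr hδ)
  have hcont : ContinuousAt (fun x => areaFactor (gradient u x)) x₀ :=
    (continuous_areaFactor.comp (continuous_gradient hu)).continuousAt
  have hW0 := areaFactor_pos g
  have h1 : ∀ᶠ x in 𝓝 x₀, areaFactor (gradient u x) < K * areaFactor g :=
    hcont.eventually (gt_mem_nhds (by nlinarith))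
  have h2 : ∀ᶠ x in 𝓝 x₀, (K : ℝ)⁻¹ * areaFactor g < areaFactor (gradient u x) :=
    hcont.eventually (lt_mem_nhds (by nlinarith [inv_lt_one_of_one_lt₀ hK']))
  refine ⟨U ∩ {x | areaFactor (gradient u x) < K * areaFactor g ∧
    (K : ℝ)⁻¹ * areaFactor g < areaFactor (gradient u x)}, inter_mem hU (h1.and h2), ?_⟩
  intro B hB hBm
  have hdist : ∀ x ∈ B, ∀ y ∈ B, dist (graphMap u x) (graphMap u y) ≤
      K * dist (stretch g x) (stretch g y) ∧
      dist (stretch g x) (stretch g y) ≤ K * dist (graphMap u x) (graphMap u y) := by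
    intro x hx y hy
    have ha := hUF x (hB hx).1 y (hB hy).1
    rw [dist_eq_norm, dist_eq_norm, ← map_sub]
    have hs := norm_stretch g (x - y)
    have hs' := norm_le_norm_stretch g (x - y)
    change _ ≤ (1 - (K : ℝ)⁻¹) * _ at ha
    have ht1 := norm_le_norm_add_norm_sub' (graphMap u x - graphMap u y) (graphDeriv g (x - y))
    have ht2 := norm_le_norm_add_norm_sub' (graphDeriv g (x - y)) (graphMap u x - graphMap u y)
    rw [norm_sub_rev (graphDeriv g (x - y))] at ht2
    have hKK : (K : ℝ) * (K : ℝ)⁻¹ = 1 := mul_inv_cancel₀ hK0.ne'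
    have hm : (1 - (K : ℝ)⁻¹) * ‖x - y‖ ≤ (1 - (K : ℝ)⁻¹) * ‖stretch g (x - y)‖ := by gcongr
    have hn := norm_nonneg (stretch g (x - y))
    constructor
    · have h3 : 2 - (K : ℝ)⁻¹ ≤ K := by
        have : (K : ℝ) + (K : ℝ)⁻¹ - 2 = (K - 1) ^ 2 * (K : ℝ)⁻¹ := by field_simp; ring
        have : 0 ≤ (K - 1 : ℝ) ^ 2 * (K : ℝ)⁻¹ := by positivity
        linarith
      nlinarith
    · have h4 : (K : ℝ)⁻¹ * ‖stretch g (x - y)‖ ≤ ‖graphMap u x - graphMap u y‖ := by nlinarith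
      calc ‖stretch g (x - y)‖ = K * ((K : ℝ)⁻¹ * ‖stretch g (x - y)‖) := by
            rw [← mul_assoc, hKK, one_mul]
        _ ≤ _ := by gcongr
  have hA := euclideanHausdorffMeasure_image_le_of_dist_le 2 fun x hx y hy => (hdist x hx y hy).1
  have hA' := euclideanHausdorffMeasure_image_le_of_dist_le 2 fun x hx y hy => (hdist x hx y hy).2
  rw [EuclideanSpace.euclideanHausdorffMeasure_eq_volume, volume_stretch_image] at hA hA'
  constructor
  · refine hA.trans ?_
    rw [pow_succ (K : ℝ≥0∞) 2, mul_assoc]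
    refine mul_le_mul' le_rfl ?_
    rw [← setLIntegral_const, ← lintegral_const_mul' _ _ ENNReal.coe_ne_top]
    refine setLIntegral_mono' hBm fun x hx => ?_
    rw [← ENNReal.ofReal_coe_nnreal, ← ENNReal.ofReal_mul hK0.le]
    refine ENNReal.ofReal_le_ofReal ?_
    have := (hB hx).2.2
    rw [inv_mul_lt_iff₀ hK0] at this
    exact this.le
  · rw [pow_succ' (K : ℝ≥0∞) 2, mul_assoc]
    refine le_trans ?_ (mul_le_mul' le_rfl hA')
    rw [← mul_assoc, ← setLIntegral_const]
    refine setLIntegral_mono' hBm fun x hx => ?_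
    rw [← ENNReal.ofReal_coe_nnreal, ← ENNReal.ofReal_mul hK0.le]
    exact ENNReal.ofReal_le_ofReal (hB hx).2.1.le

/-- Countably many of the neighbourhoods cover the space; made disjoint, they split every measurable
set. -/
lemma measure_le_of_locally_le {X : Type*} [TopologicalSpace X] [SecondCountableTopology X]
    [MeasurableSpace X] [OpensMeasurableSpace X] {μ ν : Measure X}
    (h : ∀ x, ∃ U ∈ 𝓝 x, ∀ B ⊆ U, MeasurableSet B → μ B ≤ ν B) : μ ≤ ν := by
  choose U hU hUB using h
  obtain ⟨s, hs, hcov⟩ := TopologicalSpace.countable_cover_nhds fun x => interior_mem_nhds.2 (hU x)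
  rw [Measure.le_iff]
  intro B hB
  rcases s.eq_empty_or_nonempty with rfl | hne
  · have : B = ∅ := by
      rw [← subset_empty_iff, ← biUnion_empty fun x => interior (U x), hcov]
      exact subset_univ _
    simp [this]
  obtain ⟨e, rfl⟩ := hs.exists_eq_range hne
  rw [biUnion_range] at hcov
  set D := disjointed fun n => interior (U (e n)) with hD
  have hDm : ∀ n, MeasurableSet (D n) :=
    MeasurableSet.disjointed fun n => isOpen_interior.measurableSet
  have hBD : B = ⋃ n, B ∩ D n := by
    rw [← inter_iUnion, hD, iUnion_disjointed, hcov, inter_univ]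
  have hdis : Pairwise (Function.onFun Disjoint fun n => B ∩ D n) := fun i j hij =>
    (disjoint_disjointed _ hij).mono inter_subset_right inter_subset_right
  rw [hBD, measure_iUnion hdis fun n => hB.inter (hDm n),
    measure_iUnion hdis fun n => hB.inter (hDm n)]
  refine ENNReal.tsum_le_tsum fun n => hUB (e n) _ ?_ (hB.inter (hDm n))
  exact inter_subset_right.trans ((disjointed_subset _ n).trans interior_subset)

/-- The area formula for graphs of continuously differentiable functions. -/
theorem euclideanHausdorffMeasure_graphMap_image {u : E 2 → ℝ} (hu : ContDiff ℝ 1 u)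
    {B : Set (E 2)} (hB : MeasurableSet B) :
    (Measure.euclideanHausdorffMeasure 2 : Measure (E 3)) (graphMap u '' B) =
      ∫⁻ x in B, ENNReal.ofReal (areaFactor (gradient u x)) := by
  have hF := measurableEmbedding_graphMap hu.continuous
  set μ := (Measure.euclideanHausdorffMeasure 2 : Measure (E 3)).comap (graphMap u) with hμ
  set ν : Measure (E 2) := volume.withDensity fun x => ENNReal.ofReal (areaFactor (gradient u x))
    with hν
  have hμB : ∀ B, μ B = (Measure.euclideanHausdorffMeasure 2 : Measure (E 3)) (graphMap u '' B) :=
    fun B => hF.comap_apply _ _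
  have hνB : ∀ B, MeasurableSet B →
      ν B = ∫⁻ x in B, ENNReal.ofReal (areaFactor (gradient u x)) :=
    fun B hB => withDensity_apply _ hB
  rw [← hμB, ← hνB B hB]
  -- The local comparison globalizes for each fixed `K > 1`; equality then follows by letting `K`
  -- tend to `1`.
  have hK : ∀ K : ℝ≥0, 1 < K → μ B ≤ (K : ℝ≥0∞) ^ 3 * ν B ∧ ν B ≤ (K : ℝ≥0∞) ^ 3 * μ B := by
    intro K hK
    constructor
    · have : μ ≤ (K : ℝ≥0∞) ^ 3 • ν := measure_le_of_locally_le fun x => by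
        obtain ⟨U, hU, h⟩ := exists_nhds_comparison hu x hK
        refine ⟨U, hU, fun B hBU hB => ?_⟩
        rw [hμB, Measure.smul_apply, hνB B hB]
        exact (h B hBU hB).1
      exact this B
    · have : ν ≤ (K : ℝ≥0∞) ^ 3 • μ := measure_le_of_locally_le fun x => by
        obtain ⟨U, hU, h⟩ := exists_nhds_comparison hu x hK
        refine ⟨U, hU, fun B hBU hB => ?_⟩
        rw [Measure.smul_apply, hμB, hνB B hB]
        exact (h B hBU hB).2
      exact this B
  have hlim : ∀ c : ℝ≥0∞, Tendsto (fun K : ℝ≥0 => (K : ℝ≥0∞) ^ 3 * c) (𝓝[>] 1) (𝓝 c) := by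
    intro c
    have h1 : Tendsto (fun K : ℝ≥0 => ((K ^ 3 : ℝ≥0) : ℝ≥0∞)) (𝓝[>] 1) (𝓝 ((1 ^ 3 : ℝ≥0) : ℝ≥0∞)) :=
      (ENNReal.continuous_coe.comp (continuous_pow 3)).continuousAt.tendsto.mono_left
        nhdsWithin_le_nhds
    have h2 := ENNReal.Tendsto.mul_const (b := c) h1 (Or.inl (by simp))
    simpa using h2
  have hne : (𝓝[>] (1 : ℝ≥0)).NeBot := inferInstance
  refine le_antisymm (ge_of_tendsto (hlim _) ?_) (ge_of_tendsto (hlim _) ?_)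
  · filter_upwards [self_mem_nhdsWithin] with K h using (hK K h).1
  · filter_upwards [self_mem_nhdsWithin] with K h using (hK K h).2

/-! ### The first variation of smooth graphs -/

/-- The mean curvature of the graph of `u`, that is, the divergence of `∇u / √(1 + |∇u|²)`. -/
def meanCurvature (u : E 2 → ℝ) (x : E 2) : ℝ :=
  fderiv ℝ (fun y => gradient u y 0 / areaFactor (gradient u y)) x (EuclideanSpace.single 0 1) +
    fderiv ℝ (fun y => gradient u y 1 / areaFactor (gradient u y)) x (EuclideanSpace.single 1 1)

/-- The integrand of the first variation of the graph of `u` in the parameter domain. -/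
def variationIntegrand (u : E 2 → ℝ) (θ : E 3 → E 3) (x : E 2) : ℝ :=
  areaFactor (gradient u x) * LinearMap.trace ℝ (E 3)
    ((tangentPlane (gradient u x)).proj.comp (fderiv ℝ θ (graphMap u x))).toLinearMap

lemma fderiv_apply_eq_inner_gradient (u : E 2 → ℝ) (x v : E 2) :
    fderiv ℝ u x v = inner ℝ (gradient u x) v := by
  rw [gradient, InnerProductSpace.toDual_symm_apply]

lemma gradient_apply (u : E 2 → ℝ) (x : E 2) (i : Fin 2) :
    gradient u x i = fderiv ℝ u x (EuclideanSpace.single i 1) := by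
  rw [fderiv_apply_eq_inner_gradient, EuclideanSpace.inner_single_right]
  simp

lemma contDiff_gradient {u : E 2 → ℝ} {n : WithTop ℕ∞} (hu : ContDiff ℝ (n + 1) u) :
    ContDiff ℝ n (gradient u) :=
  (InnerProductSpace.toDual ℝ (E 2)).symm.contDiff.comp (hu.fderiv_right le_rfl)

lemma contDiff_areaFactor {n : WithTop ℕ∞} : ContDiff ℝ n areaFactor := by
  unfold areaFactor
  exact (contDiff_const.add (contDiff_norm_sq ℝ)).sqrt fun x => by positivity

lemma fderiv_gradient_comm {u : E 2 → ℝ} (hu : ContDiff ℝ 2 u) (x : E 2) (i j : Fin 2) :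
    fderiv ℝ (fun y => gradient u y i) x (EuclideanSpace.single j 1) =
      fderiv ℝ (fun y => gradient u y j) x (EuclideanSpace.single i 1) := by
  have hd : DifferentiableAt ℝ (fderiv ℝ u) x :=
    (hu.fderiv_right (m := 1) (by norm_num)).differentiable one_ne_zero x
  have hs : IsSymmSndFDerivAt ℝ u x := hu.contDiffAt.isSymmSndFDerivAt (by simp)
  have key : ∀ k l : Fin 2, fderiv ℝ (fun y => gradient u y k) x (EuclideanSpace.single l 1) =
      fderiv ℝ (fderiv ℝ u) x (EuclideanSpace.single l 1) (EuclideanSpace.single k 1) := by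
    intro k l
    simp only [gradient_apply]
    rw [fderiv_clm_apply hd (differentiableAt_const _)]
    simp
  rw [key, key, hs.eq]

lemma integral_fderiv_apply_eq_zero {X : E 2 → ℝ} (hX : ContDiff ℝ 1 X)
    (hc : HasCompactSupport X) (v : E 2) : ∫ x, fderiv ℝ X x v = 0 := by
  have hi : Integrable fun x => fderiv ℝ X x v :=
    ((hX.continuous_fderiv one_ne_zero).clm_apply continuous_const).integrable_of_hasCompactSupport
      (hc.fderiv_apply (𝕜 := ℝ) v)
  have := integral_mul_fderiv_eq_neg_fderiv_mul_of_integrable (μ := (volume : Measure (E 2)))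
    (f := fun _ => (1 : ℝ)) (g := X) (v := v) (by simp) (by simpa using hi)
    (by simpa using hX.continuous.integrable_of_hasCompactSupport hc)
    (fun x _ => differentiableAt_const _) (fun x _ => hX.differentiable one_ne_zero x)
  simpa using this

/-- The first variation of the graph of a twice continuously differentiable function. -/
theorem integral_variationIntegrand {u : E 2 → ℝ} (hu : ContDiff ℝ 2 u) {θ : E 3 → E 3}
    (hθ : ContDiff ℝ 1 θ) (hc : HasCompactSupport θ) :
    Integrable (variationIntegrand u θ) ∧
    ∫ x, variationIntegrand u θ x =
      -∫ x, meanCurvature u x * inner ℝ (normalVec (gradient u x)) (θ (graphMap u x)) := by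
  have hg : ContDiff ℝ 1 (gradient u) := contDiff_gradient (by simpa [one_add_one_eq_two] using hu)
  set p : E 2 → ℝ := fun y => gradient u y 0 with hp
  set q : E 2 → ℝ := fun y => gradient u y 1 with hq
  set W : E 2 → ℝ := fun y => areaFactor (gradient u y) with hW
  set a : E 2 → ℝ := fun y => p y / W y with ha
  set b : E 2 → ℝ := fun y => q y / W y with hb
  have hp1 : ContDiff ℝ 1 p := contDiff_euclidean.1 hg 0
  have hq1 : ContDiff ℝ 1 q := contDiff_euclidean.1 hg 1
  have hW1 : ContDiff ℝ 1 W := contDiff_areaFactor.comp hg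
  have hW0 : ∀ x, W x ≠ 0 := fun x => (areaFactor_pos _).ne'
  have ha1 : ContDiff ℝ 1 a := hp1.div hW1 hW0
  have hb1 : ContDiff ℝ 1 b := hq1.div hW1 hW0
  have hF1 : ContDiff ℝ 1 (graphMap u) := by
    rw [contDiff_euclidean]
    intro i
    fin_cases i
    · exact (PiLp.proj 2 (fun _ : Fin 2 => ℝ) (𝕜 := ℝ) 0).contDiff
    · exact (PiLp.proj 2 (fun _ : Fin 2 => ℝ) (𝕜 := ℝ) 1).contDiff
    · exact hu.of_le (by norm_num)
  set Θ : E 2 → E 3 := fun x => θ (graphMap u x) with hΘ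
  have hΘ1 : ContDiff ℝ 1 Θ := hθ.comp hF1
  have hΘi : ∀ i, ContDiff ℝ 1 fun x => Θ x i := contDiff_euclidean.1 hΘ1
  have hΘc : HasCompactSupport Θ :=
    hc.comp_isClosedEmbedding (isClosedEmbedding_graphMap hu.continuous)
  have hΘic : ∀ i, HasCompactSupport fun x => Θ x i := fun i =>
    hΘc.comp_left (g := fun v : E 3 => v i) rfl
  -- `X` and `Y` carry the coefficients from `areaFactor_mul_trace`. In their divergence, the
  -- derivatives of `Θ` reproduce the integrand. The derivatives of the coefficients add up to the
  -- curvature term `R`, by symmetry of second derivatives and `W ∇W = p ∇p + q ∇q`.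
  set X : E 2 → ℝ := fun x => (W x - p x * a x) * Θ x 0 - q x * a x * Θ x 1 + a x * Θ x 2 with hX
  set Y : E 2 → ℝ := fun x => -(p x * b x) * Θ x 0 + (W x - q x * b x) * Θ x 1 + b x * Θ x 2 with hY
  have hX1 : ContDiff ℝ 1 X :=
    (((hW1.sub (hp1.mul ha1)).mul (hΘi 0)).sub ((hq1.mul ha1).mul (hΘi 1))).add (ha1.mul (hΘi 2))
  have hY1 : ContDiff ℝ 1 Y :=
    (((hp1.mul hb1).neg.mul (hΘi 0)).add ((hW1.sub (hq1.mul hb1)).mul (hΘi 1))).add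
      (hb1.mul (hΘi 2))
  have hXc : HasCompactSupport X :=
    (((hΘic 0).mul_left).sub ((hΘic 1).mul_left)).add ((hΘic 2).mul_left)
  have hYc : HasCompactSupport Y :=
    (((hΘic 0).mul_left).add ((hΘic 1).mul_left)).add ((hΘic 2).mul_left)
  set R : E 2 → ℝ := fun x => meanCurvature u x * inner ℝ (normalVec (gradient u x)) (Θ x) with hR
  have key : ∀ x, variationIntegrand u θ x = fderiv ℝ X x (EuclideanSpace.single 0 1) +
      fderiv ℝ Y x (EuclideanSpace.single 1 1) - R x := by
    intro x
    have dp := (hp1.differentiable one_ne_zero x).hasFDerivAt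
    have dq := (hq1.differentiable one_ne_zero x).hasFDerivAt
    have dW := (hW1.differentiable one_ne_zero x).hasFDerivAt
    have da := (ha1.differentiable one_ne_zero x).hasFDerivAt
    have db := (hb1.differentiable one_ne_zero x).hasFDerivAt
    have dΘ : ∀ i, HasFDerivAt (fun x => Θ x i) ((PiLp.proj 2 (fun _ : Fin 3 => ℝ) (𝕜 := ℝ) i).comp
        ((fderiv ℝ θ (graphMap u x)).comp (graphDeriv (gradient u x)))) x := by
      intro i
      refine HasFDerivAt.comp x (PiLp.proj 2 (fun _ : Fin 3 => ℝ) (𝕜 := ℝ) i).hasFDerivAt ?_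
      refine HasFDerivAt.comp x (hθ.differentiable one_ne_zero _).hasFDerivAt ?_
      exact hasFDerivAt_graphMap
        ((hu.differentiable two_ne_zero x).hasGradientAt)
    have dX := (((dW.sub (dp.mul da)).mul (dΘ 0)).sub ((dq.mul da).mul (dΘ 1))).add (da.mul (dΘ 2))
    have dY := (((dp.mul db).neg.mul (dΘ 0)).add ((dW.sub (dq.mul db)).mul (dΘ 1))).add
      (db.mul (dΘ 2))
    have hX' : fderiv ℝ X x = _ := HasFDerivAt.fderiv dX
    have hY' : fderiv ℝ Y x = _ := HasFDerivAt.fderiv dY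
    have hWW : ∀ v, W x * fderiv ℝ W x v = p x * fderiv ℝ p x v + q x * fderiv ℝ q x v := by
      intro v
      have h1 : (fun y => W y * W y) = fun y => 1 + p y * p y + q y * q y := by
        funext y
        have := areaFactor_sq (gradient u y)
        simp only [hW, hp, hq]
        linarith
      have h2 : HasFDerivAt (fun y => 1 + p y * p y + q y * q y) _ x :=
        ((hasFDerivAt_const (1 : ℝ) x).add (dp.mul dp)).add (dq.mul dq)
      have h3 := (dW.mul dW)
      rw [show (W * W) = fun y => W y * W y from rfl, h1] at h3
      have h4 := congrArg (fun L : E 2 →L[ℝ] ℝ => L v) (h3.unique h2)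
      simp at h4
      linarith
    have hsym : fderiv ℝ p x (EuclideanSpace.single 1 1) =
      fderiv ℝ q x (EuclideanSpace.single 0 1) := fderiv_gradient_comm hu x 0 1
    have hW' : ∀ v, fderiv ℝ W x v = a x * fderiv ℝ p x v + b x * fderiv ℝ q x v := by
      intro v
      have := hWW v
      simp only [ha, hb]
      field_simp [hW0 x]
      linarith
    have hD0 : graphDeriv (gradient u x) (EuclideanSpace.single 0 1) = !₂[1, 0, p x] := by
      ext i; fin_cases i <;> simp [graphDeriv_apply, gradient_apply, hp]
    have hD1 : graphDeriv (gradient u x) (EuclideanSpace.single 1 1) = !₂[0, 1, q x] := by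
      ext i; fin_cases i <;> simp [graphDeriv_apply, gradient_apply, hq]
    rw [variationIntegrand, areaFactor_mul_trace, hX', hY', hR]
    simp only [meanCurvature, inner_three, normalVec]
    simp [hD0, hD1, hW', hsym]
    simp only [ha, hb, hp, hq, hW]
    ring
  have hXi : Integrable fun x => fderiv ℝ X x (EuclideanSpace.single 0 1) :=
    ((hX1.continuous_fderiv one_ne_zero).clm_apply
      continuous_const).integrable_of_hasCompactSupport (hXc.fderiv_apply (𝕜 := ℝ) _)
  have hYi : Integrable fun x => fderiv ℝ Y x (EuclideanSpace.single 1 1) :=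
    ((hY1.continuous_fderiv one_ne_zero).clm_apply
      continuous_const).integrable_of_hasCompactSupport (hYc.fderiv_apply (𝕜 := ℝ) _)
  have hRi : Integrable R := by
    refine Continuous.integrable_of_hasCompactSupport ?_ ?_
    · refine Continuous.mul ?_ ?_
      · exact ((ha1.continuous_fderiv one_ne_zero).clm_apply continuous_const).add
          ((hb1.continuous_fderiv one_ne_zero).clm_apply continuous_const)
      · exact (continuous_normalVec.comp hg.continuous).inner hΘ1.continuous
    · refine HasCompactSupport.mul_left ?_
      refine hΘc.mono fun x hx => ?_
      contrapose! hx
      simp only [Function.mem_support, not_not] at hx ⊢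
      simp [hx]
  have key' : variationIntegrand u θ = fun x => fderiv ℝ X x (EuclideanSpace.single 0 1) +
      fderiv ℝ Y x (EuclideanSpace.single 1 1) - R x := funext key
  rw [key']
  refine ⟨(hXi.add hYi).sub hRi, ?_⟩
  refine (integral_sub (hXi.add hYi) hRi).trans ?_
  simp only [Pi.add_apply]
  rw [integral_add hXi hYi,
    integral_fderiv_apply_eq_zero hX1 hXc, integral_fderiv_apply_eq_zero hY1 hYc]
  simp

/-! ### Catenoidal bumps -/

lemma exists_abs_deriv_smoothTransition_le :
    ∃ M : ℝ, 0 < M ∧ ∀ t, |deriv Real.smoothTransition t| ≤ M := by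
  have hc : Continuous (deriv Real.smoothTransition) :=
    (Real.smoothTransition.contDiff (n := 1)).continuous_deriv le_rfl
  obtain ⟨M, hM⟩ := isCompact_Icc.exists_bound_of_continuousOn (s := Icc (0 : ℝ) 1) hc.continuousOn
  refine ⟨max M 1, by positivity, fun t => ?_⟩
  by_cases ht : t ∈ Icc (0 : ℝ) 1
  · exact (hM t ht).trans (le_max_left _ _)
  · suffices deriv Real.smoothTransition t = 0 by simp [this]
    rw [mem_Icc, not_and_or, not_le, not_le] at ht
    rcases ht with ht | ht
    · have : Real.smoothTransition =ᶠ[𝓝 t] fun _ => 0 := by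
        filter_upwards [gt_mem_nhds ht] with s hs using Real.smoothTransition.zero_of_nonpos hs.le
      rw [this.deriv_eq, deriv_const]
    · have : Real.smoothTransition =ᶠ[𝓝 t] fun _ => 1 := by
        filter_upwards [lt_mem_nhds ht] with s hs using Real.smoothTransition.one_of_one_le hs.le
      rw [this.deriv_eq, deriv_const]

lemma deriv_smoothTransition_of_one_lt {t : ℝ} (ht : 1 < t) :
    deriv Real.smoothTransition t = 0 := by
  have : Real.smoothTransition =ᶠ[𝓝 t] fun _ => 1 := by
    filter_upwards [lt_mem_nhds ht] with s hs using Real.smoothTransition.one_of_one_le hs.le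
  rw [this.deriv_eq, deriv_const]

lemma deriv_smoothTransition_of_neg {t : ℝ} (ht : t < 0) :
    deriv Real.smoothTransition t = 0 := by
  have : Real.smoothTransition =ᶠ[𝓝 t] fun _ => 0 := by
    filter_upwards [gt_mem_nhds ht] with s hs using Real.smoothTransition.zero_of_nonpos hs.le
  rw [this.deriv_eq, deriv_const]

/-- The flux of the bump through the circle of squared radius `t`. -/
def bumpFlux (m a b t : ℝ) : ℝ :=
  m * Real.smoothTransition (t / a - 1) * Real.smoothTransition (2 - t / b)

/-- The radial factor of `∇u / √(1 + |∇u|²)`. -/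
def bumpSlope (m a b t : ℝ) : ℝ := bumpFlux m a b t / t

/-- The radial factor of the gradient of the bump. -/
def bumpGrad (m a b t : ℝ) : ℝ :=
  bumpSlope m a b t / √(1 - bumpSlope m a b t ^ 2 * t)

/-- A radial bump, which is a piece of a catenoid in the range `2 * a ≤ ‖x - c‖ ^ 2 ≤ b`. -/
def bump (m a b : ℝ) (c x : E 2) : ℝ :=
  ((∫ t in (0 : ℝ)..‖x - c‖ ^ 2, bumpGrad m a b t) - ∫ t in (0 : ℝ)..(2 * b), bumpGrad m a b t) / 2

section

variable {m a b : ℝ}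

lemma contDiff_bumpFlux {n : ℕ∞} : ContDiff ℝ n (bumpFlux m a b) := by
  unfold bumpFlux
  refine (contDiff_const.mul (Real.smoothTransition.contDiff.comp ?_)).mul
    (Real.smoothTransition.contDiff.comp ?_)
  · exact (contDiff_id.div_const a).sub contDiff_const
  · exact contDiff_const.sub (contDiff_id.div_const b)

lemma bumpFlux_of_le (ha : 0 < a) {t : ℝ} (ht : t ≤ a) : bumpFlux m a b t = 0 := by
  rw [bumpFlux, Real.smoothTransition.zero_of_nonpos (x := t / a - 1), mul_zero, zero_mul]
  rw [sub_nonpos, div_le_one ha]; exact ht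

lemma bumpFlux_of_ge (hb : 0 < b) {t : ℝ} (ht : 2 * b ≤ t) : bumpFlux m a b t = 0 := by
  rw [bumpFlux, Real.smoothTransition.zero_of_nonpos (x := 2 - t / b), mul_zero]
  rw [sub_nonpos, le_div_iff₀ hb]; exact ht

lemma bumpFlux_of_mem (ha : 0 < a) (hb : 0 < b) {t : ℝ} (ht : 2 * a ≤ t) (ht' : t ≤ b) :
    bumpFlux m a b t = m := by
  rw [bumpFlux, Real.smoothTransition.one_of_one_le, Real.smoothTransition.one_of_one_le, mul_one,
    mul_one]
  · have : t / b ≤ 1 := (div_le_one hb).2 ht'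
    linarith
  · have : 2 ≤ t / a := (le_div_iff₀ ha).2 ht
    linarith

lemma bumpFlux_sq_le (t : ℝ) : bumpFlux m a b t ^ 2 ≤ m ^ 2 := by
  have h1 := Real.smoothTransition.nonneg (t / a - 1)
  have h2 := Real.smoothTransition.le_one (t / a - 1)
  have h3 := Real.smoothTransition.nonneg (2 - t / b)
  have h4 := Real.smoothTransition.le_one (2 - t / b)
  rw [bumpFlux, mul_assoc, mul_pow]
  refine mul_le_of_le_one_right (sq_nonneg m) (pow_le_one₀ (mul_nonneg h1 h3) ?_)
  exact mul_le_one₀ h2 h3 h4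

/-- Division by `t` does no harm at the origin because the flux vanishes for `t ≤ a`. -/
lemma contDiff_bumpSlope (ha : 0 < a) {n : ℕ∞} : ContDiff ℝ n (bumpSlope m a b) := by
  rw [contDiff_iff_contDiffAt]
  intro t
  rcases lt_or_ge t a with h | h
  · have : bumpSlope m a b =ᶠ[𝓝 t] fun _ => 0 := by
      filter_upwards [gt_mem_nhds h] with s hs
      rw [bumpSlope, bumpFlux_of_le ha hs.le, zero_div]
    exact contDiffAt_const.congr_of_eventuallyEq this
  · exact contDiff_bumpFlux.contDiffAt.div contDiffAt_id (ha.trans_le h).ne'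

lemma bumpFlux_eq (ha : 0 < a) (t : ℝ) : bumpFlux m a b t = t * bumpSlope m a b t := by
  rcases eq_or_ne t 0 with rfl | h
  · rw [bumpFlux_of_le ha ha.le, zero_mul]
  · rw [bumpSlope, mul_div_cancel₀ _ h]

lemma bumpSlope_sq_mul (t : ℝ) :
    bumpSlope m a b t ^ 2 * t = bumpFlux m a b t ^ 2 / t := by
  rcases eq_or_ne t 0 with rfl | h
  · simp
  · rw [bumpSlope]; field_simp

lemma bumpSlope_sq_mul_le (ha : 0 < a) (t : ℝ) : bumpSlope m a b t ^ 2 * t ≤ m ^ 2 / a := by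
  rcases le_or_gt t a with h | h
  · rw [bumpSlope, bumpFlux_of_le ha h]; simp; positivity
  · rw [bumpSlope_sq_mul]
    have := bumpFlux_sq_le (m := m) (a := a) (b := b) t
    gcongr

/-- The slope of a surface with flux `m` at radius `√t` is finite only if `m ^ 2 < t`. The condition
`4 * m ^ 2 ≤ a` keeps the radicand in `bumpGrad` away from zero. -/
lemma one_sub_bumpSlope_pos (ha : 0 < a) (hm : 4 * m ^ 2 ≤ a) (t : ℝ) :
    3 / 4 ≤ 1 - bumpSlope m a b t ^ 2 * t := by
  have h := bumpSlope_sq_mul_le (m := m) (b := b) ha t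
  have : m ^ 2 / a ≤ 1 / 4 := by rw [div_le_div_iff₀ ha (by norm_num)]; linarith
  linarith

lemma contDiff_bumpGrad (ha : 0 < a) (hm : 4 * m ^ 2 ≤ a) {n : ℕ∞} :
    ContDiff ℝ n (bumpGrad m a b) := by
  have hk := contDiff_bumpSlope (m := m) (b := b) ha (n := n)
  have hpos : ∀ t, 0 < 1 - bumpSlope m a b t ^ 2 * t := fun t => by
    linarith [one_sub_bumpSlope_pos (b := b) ha hm t]
  exact hk.div ((contDiff_const.sub ((hk.pow 2).mul contDiff_id)).sqrt fun t => (hpos t).ne')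
    fun t => (Real.sqrt_pos.2 (hpos t)).ne'

lemma bumpGrad_sq_mul (ha : 0 < a) (hm : 4 * m ^ 2 ≤ a) (t : ℝ) :
    bumpGrad m a b t ^ 2 * t =
      bumpSlope m a b t ^ 2 * t / (1 - bumpSlope m a b t ^ 2 * t) := by
  have := one_sub_bumpSlope_pos (b := b) ha hm t
  rw [bumpGrad, div_pow, Real.sq_sqrt (by linarith)]
  ring

lemma hasGradientAt_bump (ha : 0 < a) (hm : 4 * m ^ 2 ≤ a) (c x : E 2) :
    HasGradientAt (bump m a b c) (bumpGrad m a b (‖x - c‖ ^ 2) • (x - c)) x := by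
  have hg : Continuous (bumpGrad m a b) := (contDiff_bumpGrad (n := 0) ha hm).continuous
  rw [hasGradientAt_iff_hasFDerivAt]
  have h1 : HasFDerivAt (fun x : E 2 => ‖x - c‖ ^ 2) _ x :=
    ((hasFDerivAt_id x).sub_const c).norm_sq
  have h2 : HasDerivAt (fun s => ∫ t in (0 : ℝ)..s, bumpGrad m a b t)
      (bumpGrad m a b (‖x - c‖ ^ 2)) (‖x - c‖ ^ 2) :=
    intervalIntegral.integral_hasDerivAt_right (hg.intervalIntegrable _ _)
      (hg.stronglyMeasurableAtFilter _ _) hg.continuousAt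
  have h3 := ((h2.comp_hasFDerivAt x h1).sub_const
    (∫ t in (0 : ℝ)..(2 * b), bumpGrad m a b t)).mul_const (1 / 2)
  have h4 : bump m a b c = fun y => ((∫ t in (0 : ℝ)..‖y - c‖ ^ 2, bumpGrad m a b t) -
      ∫ t in (0 : ℝ)..(2 * b), bumpGrad m a b t) * (1 / 2) := by
    funext y; simp only [bump]; ring
  rw [h4]
  refine HasFDerivAt.congr_fderiv h3 ?_
  ext v
  simp [inner_two]
  ring

lemma gradient_bump (ha : 0 < a) (hm : 4 * m ^ 2 ≤ a) (c x : E 2) :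
    gradient (bump m a b c) x = bumpGrad m a b (‖x - c‖ ^ 2) • (x - c) :=
  (hasGradientAt_bump ha hm c x).gradient

lemma contDiff_bump (ha : 0 < a) (hm : 4 * m ^ 2 ≤ a) (c : E 2) :
    ContDiff ℝ 2 (bump m a b c) := by
  refine (contDiff_succ_iff_fderiv (n := 1)).2 ?_
  refine ⟨fun x => (hasGradientAt_bump ha hm c x).differentiableAt, by simp, ?_⟩
  have : fderiv ℝ (bump m a b c) = fun x =>
      InnerProductSpace.toDual ℝ (E 2) (bumpGrad m a b (‖x - c‖ ^ 2) • (x - c)) := by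
    funext x
    exact (hasGradientAt_iff_hasFDerivAt.1 (hasGradientAt_bump ha hm c x)).fderiv
  rw [this]
  refine (InnerProductSpace.toDual ℝ (E 2)).contDiff.comp ?_
  have hx : ContDiff ℝ 1 fun x : E 2 => x - c := contDiff_id.sub contDiff_const
  exact ((contDiff_bumpGrad (n := 1) ha hm).comp (hx.norm_sq ℝ)).smul hx

lemma bump_eq_zero (ha : 0 < a) (hb : 0 < b) (hm : 4 * m ^ 2 ≤ a) {c x : E 2} (hx : 2 * b ≤ ‖x - c‖ ^ 2) : bump m a b c x = 0 := by
  have h0 : ∀ t, 2 * b ≤ t → bumpGrad m a b t = 0 := by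
    intro t ht
    rw [bumpGrad, bumpSlope, bumpFlux_of_ge hb ht, zero_div, zero_div]
  have hg : Continuous (bumpGrad m a b) := (contDiff_bumpGrad (n := 0) ha hm).continuous
  rw [bump, intervalIntegral.integral_interval_sub_left (hg.intervalIntegrable _ _)
    (hg.intervalIntegrable _ _), intervalIntegral.integral_congr (g := fun _ => 0)]
  · simp
  · intro t ht
    rw [uIcc_of_le hx] at ht
    exact h0 t ht.1

lemma norm_gradient_bump_sq (ha : 0 < a) (hm : 4 * m ^ 2 ≤ a) (c x : E 2) :
    ‖gradient (bump m a b c) x‖ ^ 2 = bumpSlope m a b (‖x - c‖ ^ 2) ^ 2 * ‖x - c‖ ^ 2 /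
      (1 - bumpSlope m a b (‖x - c‖ ^ 2) ^ 2 * ‖x - c‖ ^ 2) := by
  rw [gradient_bump ha hm, norm_smul, mul_pow, Real.norm_eq_abs, sq_abs, bumpGrad_sq_mul ha hm]

lemma norm_gradient_bump_sq_le (ha : 0 < a) (hm : 4 * m ^ 2 ≤ a) (c x : E 2) :
    ‖gradient (bump m a b c) x‖ ^ 2 ≤ 2 * m ^ 2 / a := by
  rw [norm_gradient_bump_sq ha hm]
  have h1 := one_sub_bumpSlope_pos (b := b) ha hm (‖x - c‖ ^ 2)
  have h2 := bumpSlope_sq_mul_le (m := m) (b := b) ha (‖x - c‖ ^ 2)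
  have h3 : 0 ≤ m ^ 2 / a := by positivity
  rw [div_le_iff₀ (by linarith), mul_div_assoc]
  nlinarith

/-- `bumpGrad` is built to invert the normalization by the area factor, so the normalized gradient
is `k(t) (x - c)` with `k = bumpSlope` and `t = ‖x - c‖ ^ 2`. In the plane its divergence is `2 k +
2 t k' = 2 (t k)'`. In particular the curvature vanishes where the flux is constant. -/
lemma meanCurvature_bump (ha : 0 < a) (hm : 4 * m ^ 2 ≤ a) (c x : E 2) :
    meanCurvature (bump m a b c) x = 2 * deriv (bumpFlux m a b) (‖x - c‖ ^ 2) := by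
  have hslope : ∀ y : E 2, ∀ i, gradient (bump m a b c) y i /
      areaFactor (gradient (bump m a b c) y) = bumpSlope m a b (‖y - c‖ ^ 2) * (y i - c i) := by
    intro y i
    have h1 := one_sub_bumpSlope_pos (b := b) ha hm (‖y - c‖ ^ 2)
    set s := 1 - bumpSlope m a b (‖y - c‖ ^ 2) ^ 2 * ‖y - c‖ ^ 2 with hs
    have hs0 : 0 < s := by linarith
    have hW : areaFactor (gradient (bump m a b c) y) = 1 / √s := by
      rw [areaFactor, norm_gradient_bump_sq ha hm, ← hs,
        show 1 + bumpSlope m a b (‖y - c‖ ^ 2) ^ 2 * ‖y - c‖ ^ 2 / s = 1 / s by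
          rw [eq_div_iff hs0.ne', add_mul, div_mul_cancel₀ _ hs0.ne', hs]; ring]
      rw [Real.sqrt_div zero_le_one, Real.sqrt_one]
    have hss : √s ≠ 0 := (Real.sqrt_pos.2 hs0).ne'
    rw [hW, gradient_bump ha hm, bumpGrad, ← hs]
    simp
    field_simp
  have hk : ∀ t, HasDerivAt (bumpSlope m a b) (deriv (bumpSlope m a b) t) t := fun t =>
    ((contDiff_bumpSlope ha (n := 1)).differentiable (by simp) t).hasDerivAt
  have hflux : ∀ t, deriv (bumpFlux m a b) t =
      bumpSlope m a b t + t * deriv (bumpSlope m a b) t := by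
    intro t
    have h1 : bumpFlux m a b = fun t => t * bumpSlope m a b t := funext (bumpFlux_eq ha)
    have h2 := ((hasDerivAt_id t).mul (hk t)).deriv
    rw [h1]
    refine Eq.trans h2 ?_
    simp
  have h1 : HasFDerivAt (fun x : E 2 => ‖x - c‖ ^ 2) _ x :=
    ((hasFDerivAt_id x).sub_const c).norm_sq
  have h2 := (hk (‖x - c‖ ^ 2)).comp_hasFDerivAt x h1
  have h3 : ∀ i, HasFDerivAt (fun y : E 2 => y i - c i) (PiLp.proj 2 (fun _ : Fin 2 => ℝ) (𝕜 := ℝ) i)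
      x := fun i => (PiLp.proj 2 (fun _ : Fin 2 => ℝ) (𝕜 := ℝ) i).hasFDerivAt.sub_const (c i)
  have h4 : ∀ i, fderiv ℝ (fun y : E 2 => bumpSlope m a b (‖y - c‖ ^ 2) * (y i - c i)) x = _ :=
    fun i => (h2.mul (h3 i)).fderiv
  rw [meanCurvature]
  simp only [hslope, h4, hflux]
  simp [norm_sq_two, inner_two]
  ring

lemma volume_closedBall_two (c : E 2) {r : ℝ} (hr : 0 ≤ r) :
    volume (Metric.closedBall c r) = ENNReal.ofReal (Real.pi * r ^ 2) := by
  rw [EuclideanSpace.volume_closedBall, ← ENNReal.ofReal_pow hr, ← ENNReal.ofReal_mul (by positivity)]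
  congr 1
  have : Real.Gamma 2 = 1 := by simp
  simp [Real.sq_sqrt Real.pi_pos.le]
  norm_num [this]
  ring

lemma volume_ball_two (c : E 2) {r : ℝ} (hr : 0 ≤ r) :
    volume (Metric.ball c r) = ENNReal.ofReal (Real.pi * r ^ 2) := by
  rw [← Measure.addHaar_closedBall_eq_addHaar_ball, volume_closedBall_two c hr]

end

/-- The total mean curvature of a bump is proportional to its flux. -/
lemma exists_lintegral_meanCurvature_bump_le : ∃ M : ℝ, 0 < M ∧ ∀ (m a b : ℝ) (c : E 2), 0 ≤ m →
    0 < a → 0 < b → 4 * m ^ 2 ≤ a →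
    ∫⁻ x, ENNReal.ofReal |meanCurvature (bump m a b c) x| ≤ ENNReal.ofReal (M * m) := by
  obtain ⟨M, hM0, hM⟩ := exists_abs_deriv_smoothTransition_le
  refine ⟨8 * Real.pi * M, by positivity, fun m a b c hm0 ha hb hm => ?_⟩
  have hST := fun t => ((Real.smoothTransition.contDiff (n := 1)).differentiable (by simp)
    t).hasDerivAt
  have hder : ∀ t, deriv (bumpFlux m a b) t =
      m * (deriv Real.smoothTransition (t / a - 1) * (1 / a)) * Real.smoothTransition (2 - t / b) +
      m * Real.smoothTransition (t / a - 1) * (deriv Real.smoothTransition (2 - t / b) * -(1 / b))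
      := by
    intro t
    have h1 : HasDerivAt (fun t => t / a - 1) (1 / a) t :=
      ((hasDerivAt_id t).div_const a).sub_const 1
    have h2 : HasDerivAt (fun t => 2 - t / b) (-(1 / b)) t :=
      ((hasDerivAt_id t).div_const b).const_sub 2
    exact ((((hST _).comp t h1).const_mul m).mul ((hST _).comp t h2)).deriv
  -- One term for each transition layer: the inner cutoff is constant for `t > 2 * a`, the outer one
  -- for `t > 2 * b`.
  have hbd : ∀ x, |meanCurvature (bump m a b c) x| ≤
      (Metric.closedBall c √(2 * a)).indicator (fun _ => 2 * (m * M / a)) x +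
      (Metric.closedBall c √(2 * b)).indicator (fun _ => 2 * (m * M / b)) x := by
    intro x
    rw [meanCurvature_bump ha hm, abs_mul, abs_two, hder]
    set t := ‖x - c‖ ^ 2 with ht
    have hball : ∀ s : ℝ, 0 < s → x ∉ Metric.closedBall c √s → s < t := by
      intro s hs hx
      rw [Metric.mem_closedBall, dist_eq_norm, not_le, Real.sqrt_lt' (by_contra fun h => ?_)] at hx
      · exact hx
      · have : ‖x - c‖ = 0 := le_antisymm (not_lt.1 h) (norm_nonneg _)
        rw [this] at hx
        exact absurd hx (not_lt.2 (Real.sqrt_nonneg s))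
    have hs1 := Real.smoothTransition.nonneg (2 - t / b)
    have hs2 := Real.smoothTransition.le_one (2 - t / b)
    have hs3 := Real.smoothTransition.nonneg (t / a - 1)
    have hs4 := Real.smoothTransition.le_one (t / a - 1)
    have hA : |m * (deriv Real.smoothTransition (t / a - 1) * (1 / a)) *
        Real.smoothTransition (2 - t / b)| ≤
        (Metric.closedBall c √(2 * a)).indicator (fun _ => m * M / a) x := by
      by_cases hx : x ∈ Metric.closedBall c √(2 * a)
      · rw [indicator_of_mem hx, abs_mul, abs_mul, abs_mul, abs_of_nonneg hm0,
          abs_of_nonneg (one_div_pos.2 ha).le, abs_of_nonneg hs1]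
        calc m * (|deriv Real.smoothTransition (t / a - 1)| * (1 / a)) *
              Real.smoothTransition (2 - t / b) ≤ m * (M * (1 / a)) * 1 := by
              have := hM (t / a - 1)
              gcongr
          _ = m * M / a := by ring
      · rw [indicator_of_notMem hx, deriv_smoothTransition_of_one_lt]
        · simp
        · have := hball _ (by positivity) hx
          have : 2 < t / a := (lt_div_iff₀ ha).2 this
          linarith
    have hB : |m * Real.smoothTransition (t / a - 1) *
        (deriv Real.smoothTransition (2 - t / b) * -(1 / b))| ≤
        (Metric.closedBall c √(2 * b)).indicator (fun _ => m * M / b) x := by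
      by_cases hx : x ∈ Metric.closedBall c √(2 * b)
      · rw [indicator_of_mem hx, abs_mul, abs_mul, abs_mul, abs_of_nonneg hm0, abs_neg,
          abs_of_nonneg (one_div_pos.2 hb).le, abs_of_nonneg hs3]
        calc m * Real.smoothTransition (t / a - 1) *
              (|deriv Real.smoothTransition (2 - t / b)| * (1 / b)) ≤ m * 1 * (M * (1 / b)) := by
              have := hM (2 - t / b)
              gcongr
          _ = m * M / b := by ring
      · rw [indicator_of_notMem hx, deriv_smoothTransition_of_neg]
        · simp
        · have := hball _ (by positivity) hx
          have : 2 < t / b := (lt_div_iff₀ hb).2 this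
          linarith
    have htri := abs_add_le (m * (deriv Real.smoothTransition (t / a - 1) * (1 / a)) *
        Real.smoothTransition (2 - t / b)) (m * Real.smoothTransition (t / a - 1) *
        (deriv Real.smoothTransition (2 - t / b) * -(1 / b)))
    have e1 : ∀ s : Set (E 2), ∀ r : ℝ, s.indicator (fun _ => 2 * r) x =
        2 * s.indicator (fun _ => r) x := by
      intro s r
      by_cases hx : x ∈ s
      · rw [indicator_of_mem hx, indicator_of_mem hx]
      · rw [indicator_of_notMem hx, indicator_of_notMem hx, mul_zero]
    rw [e1, e1]
    linarith
  -- The area `2 * π * s` of the disk cancels the factor `1 / s`, which makes the bound independent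
  -- of `a` and `b`.
  have hstep : ∀ s : ℝ, 0 < s → ∫⁻ x, ENNReal.ofReal
      ((Metric.closedBall c √(2 * s)).indicator (fun _ => 2 * (m * M / s)) x) =
      ENNReal.ofReal (4 * Real.pi * M * m) := by
    intro s hs
    have : ∀ x, ENNReal.ofReal
        ((Metric.closedBall c √(2 * s)).indicator (fun _ => 2 * (m * M / s)) x) =
        (Metric.closedBall c √(2 * s)).indicator (fun _ => ENNReal.ofReal (2 * (m * M / s))) x := by
      intro x
      by_cases hx : x ∈ Metric.closedBall c √(2 * s)
      · rw [indicator_of_mem hx, indicator_of_mem hx]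
      · rw [indicator_of_notMem hx, indicator_of_notMem hx, ENNReal.ofReal_zero]
    simp_rw [this]
    rw [lintegral_indicator Metric.isClosed_closedBall.measurableSet, setLIntegral_const,
      volume_closedBall_two c (Real.sqrt_nonneg _), ← ENNReal.ofReal_mul (by positivity),
      Real.sq_sqrt (by positivity)]
    congr 1
    field_simp
    ring
  calc ∫⁻ x, ENNReal.ofReal |meanCurvature (bump m a b c) x|
      ≤ ∫⁻ x, (ENNReal.ofReal
        ((Metric.closedBall c √(2 * a)).indicator (fun _ => 2 * (m * M / a)) x) + ENNReal.ofReal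
        ((Metric.closedBall c √(2 * b)).indicator (fun _ => 2 * (m * M / b)) x)) :=
        lintegral_mono fun x => (ENNReal.ofReal_le_ofReal (hbd x)).trans ENNReal.ofReal_add_le
    _ = ENNReal.ofReal (8 * Real.pi * M * m) := by
        rw [lintegral_add_left, hstep a ha, hstep b hb,
          ← ENNReal.ofReal_add (by positivity) (by positivity)]
        · congr 1; ring
        · exact (measurable_const.indicator
            Metric.isClosed_closedBall.measurableSet).ennreal_ofReal

/-- The Dirichlet energy of a bump is logarithmically larger than the square of its flux. -/
lemma le_setLIntegral_norm_gradient_bump {m a b : ℝ} (c : E 2) (ha : 0 < a) (hb : 0 < b)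
    (hab : 2 * a ≤ b) (hm : 4 * m ^ 2 ≤ a) :
    ENNReal.ofReal (m ^ 2 * Real.log (b / (2 * a))) ≤
      ∫⁻ x in Metric.closedBall c √b, ENNReal.ofReal (‖gradient (bump m a b c) x‖ ^ 2) := by
  -- On this annulus the flux is `m`, and the squared slope is `s / (1 - s) ≥ s` with `s = m ^ 2 / r
  -- ^ 2`. Integrating `m ^ 2 / r ^ 2` over the annulus gives the logarithm, with a factor `π` that
  -- is dropped.
  set φ : ℝ → ℝ := (Icc √(2 * a) √b).indicator fun r => m ^ 2 / r ^ 2 with hφ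
  have hφm : Measurable φ :=
    (measurable_const.div (measurable_id.pow_const 2)).indicator measurableSet_Icc
  have hφ0 : ∀ r, 0 ≤ φ r := fun r => indicator_nonneg (fun _ _ => by positivity) r
  have h2a : 0 < √(2 * a) := Real.sqrt_pos.2 (by positivity)
  have hint : ∫ x : E 2, φ ‖x‖ = Real.pi * (m ^ 2 * Real.log (b / (2 * a))) := by
    rw [integral_fun_norm_addHaar]
    have hb1 : (volume : Measure (E 2)).real (Metric.ball 0 1) = Real.pi := by
      rw [Measure.real, volume_ball_two _ zero_le_one, ENNReal.toReal_ofReal] <;> simp [Real.pi_pos.le]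
    have hI : ∫ r in Ioi (0 : ℝ), r ^ (Module.finrank ℝ (E 2) - 1) • φ r =
        m ^ 2 * (Real.log (b / (2 * a)) / 2) := by
      have e1 : ∀ r : ℝ, r ^ (Module.finrank ℝ (E 2) - 1) • φ r =
          (Icc √(2 * a) √b).indicator (fun r => m ^ 2 * r⁻¹) r := by
        intro r
        by_cases hr : r ∈ Icc √(2 * a) √b
        · have : r ≠ 0 := (h2a.trans_le hr.1).ne'
          simp only [hφ, indicator_of_mem hr, finrank_euclideanSpace_fin, smul_eq_mul]
          field_simp
          norm_num
          ring
        · simp only [hφ, indicator_of_notMem hr, smul_zero]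
      have hsub : Icc √(2 * a) √b ⊆ Ioi 0 := fun r hr => h2a.trans_le hr.1
      simp_rw [e1]
      rw [setIntegral_indicator measurableSet_Icc, inter_eq_right.2 hsub,
        integral_Icc_eq_integral_Ioc, ← intervalIntegral.integral_of_le (Real.sqrt_le_sqrt hab),
        intervalIntegral.integral_const_mul, integral_inv_of_pos h2a (Real.sqrt_pos.2 hb),
        ← Real.sqrt_div hb.le, Real.log_sqrt (by positivity)]
    rw [hI, hb1]
    simp
    ring
  calc ENNReal.ofReal (m ^ 2 * Real.log (b / (2 * a)))
      ≤ ENNReal.ofReal (∫ x : E 2, φ ‖x‖) := by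
        rw [hint]
        refine ENNReal.ofReal_le_ofReal (le_mul_of_one_le_left ?_ ?_)
        · exact mul_nonneg (sq_nonneg m) (Real.log_nonneg ((one_le_div (by positivity)).2 hab))
        · linarith [Real.pi_gt_three]
    _ ≤ ∫⁻ x : E 2, ENNReal.ofReal (φ ‖x‖) := by
        rw [integral_eq_lintegral_of_nonneg_ae (Eventually.of_forall fun x => hφ0 _)
          (hφm.comp measurable_norm).aestronglyMeasurable]
        exact ENNReal.ofReal_toReal_le
    _ = ∫⁻ x : E 2, ENNReal.ofReal (φ ‖x - c‖) :=
        (lintegral_sub_right_eq_self (fun x => ENNReal.ofReal (φ ‖x‖)) c).symm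
    _ ≤ _ := by
        rw [← lintegral_indicator Metric.isClosed_closedBall.measurableSet]
        refine lintegral_mono fun x => ?_
        by_cases hx : ‖x - c‖ ∈ Icc √(2 * a) √b
        · have hxb : x ∈ Metric.closedBall c √b := by
            rw [Metric.mem_closedBall, dist_eq_norm]; exact hx.2
          have h1 : 2 * a ≤ ‖x - c‖ ^ 2 := (Real.sqrt_le_left (norm_nonneg _)).1 hx.1
          have h2 : ‖x - c‖ ^ 2 ≤ b := (Real.le_sqrt (norm_nonneg _) hb.le).1 hx.2
          rw [indicator_of_mem hxb]
          simp only [hφ]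
          rw [indicator_of_mem hx]
          refine ENNReal.ofReal_le_ofReal ?_
          rw [norm_gradient_bump_sq ha hm]
          have h3 := one_sub_bumpSlope_pos (b := b) ha hm (‖x - c‖ ^ 2)
          have h4 : bumpSlope m a b (‖x - c‖ ^ 2) ^ 2 * ‖x - c‖ ^ 2 = m ^ 2 / ‖x - c‖ ^ 2 := by
            rw [bumpSlope_sq_mul, bumpFlux_of_mem ha hb h1 h2]
          rw [h4] at h3 ⊢
          have h5 : 0 ≤ m ^ 2 / ‖x - c‖ ^ 2 := by positivity
          rw [le_div_iff₀ (by linarith)]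
          nlinarith
        · simp only [hφ]
          rw [indicator_of_notMem hx, ENNReal.ofReal_zero]
          exact zero_le

/-! ### The varifold associated with a Lipschitz graph -/

lemma measurable_gradient (f : E 2 → ℝ) : Measurable (gradient f) :=
  (InnerProductSpace.toDual ℝ (E 2)).symm.continuous.measurable.comp (measurable_fderiv ℝ f)

lemma norm_gradient_le {f : E 2 → ℝ} {K : ℝ≥0} (hf : LipschitzWith K f) (x : E 2) :
    ‖gradient f x‖ ≤ K := by
  rw [gradient, LinearIsometryEquiv.norm_map]
  exact norm_fderiv_le_of_lipschitz ℝ hf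

/-- The Lebesgue measure with density the area factor of the graph of `f`. -/
def graphDensity (f : E 2 → ℝ) : Measure (E 2) :=
  volume.withDensity fun x => ENNReal.ofReal (areaFactor (gradient f x))

/-- A point of the graph together with its tangent plane. -/
def gaussMap (f : E 2 → ℝ) (x : E 2) : E 3 × Gr 3 2 := (graphMap f x, tangentPlane (gradient f x))

lemma measurable_gaussMap {f : E 2 → ℝ} (hf : Continuous f) : Measurable (gaussMap f) :=
  (continuous_graphMap hf).measurable.prodMk
    (continuous_tangentPlane.measurable.comp (measurable_gradient f))

lemma volume_le_graphDensity (f : E 2 → ℝ) : volume ≤ graphDensity f := by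
  rw [graphDensity, Measure.le_iff]
  intro s hs
  rw [withDensity_apply _ hs]
  calc volume s = ∫⁻ _ in s, 1 := by simp
    _ ≤ _ := lintegral_mono fun x => by
      rw [← ENNReal.ofReal_one]
      exact ENNReal.ofReal_le_ofReal (one_le_areaFactor _)

lemma graphDensity_le {f : E 2 → ℝ} {K : ℝ≥0} (hf : LipschitzWith K f) :
    graphDensity f ≤ (ENNReal.ofReal (1 + K)) • volume := by
  rw [graphDensity, Measure.le_iff]
  intro s hs
  rw [withDensity_apply _ hs, Measure.smul_apply, smul_eq_mul, ← setLIntegral_const]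
  refine lintegral_mono fun x => ENNReal.ofReal_le_ofReal ?_
  exact (areaFactor_le _).trans (add_le_add le_rfl (norm_gradient_le hf x))

lemma graphMap_preimage_closedBall_subset (f : E 2 → ℝ) (z : E 3) (r : ℝ) :
    graphMap f ⁻¹' Metric.closedBall z r ⊆ Metric.closedBall (baseProj z) r := by
  intro x hx
  have := lipschitzWith_baseProj.dist_le_mul (graphMap f x) z
  rw [baseProj_graphMap, NNReal.coe_one, one_mul] at this
  exact this.trans hx

/-- The varifold associated with the graph of a Lipschitz function. -/
def graphVarifold (f : E 2 → ℝ) {K : ℝ≥0} (hf : LipschitzWith K f) : Varifold 3 2 where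
  measure := (graphDensity f).map (gaussMap f)
  locallyFinite := by
    refine ⟨fun p => ⟨Metric.closedBall p.1 1 ×ˢ univ, ?_, ?_⟩⟩
    · exact prod_mem_nhds (Metric.closedBall_mem_nhds _ one_pos) univ_mem
    · rw [Measure.map_apply (measurable_gaussMap hf.continuous)
        (Metric.isClosed_closedBall.measurableSet.prod MeasurableSet.univ)]
      refine (graphDensity_le hf _).trans_lt ?_
      rw [Measure.smul_apply, smul_eq_mul]
      refine ENNReal.mul_lt_top ENNReal.ofReal_lt_top ?_
      refine (measure_mono ?_).trans_lt
        (isCompact_closedBall (baseProj p.1) 1).measure_lt_top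
      exact fun x hx => graphMap_preimage_closedBall_subset f p.1 1 hx.1

section

variable {f : E 2 → ℝ} {K : ℝ≥0} (hf : LipschitzWith K f)

lemma graphVarifold_weight_eq_map :
    (graphVarifold f hf).weight = (graphDensity f).map (graphMap f) := by
  rw [Varifold.weight, graphVarifold, Measure.map_map measurable_fst
    (measurable_gaussMap hf.continuous)]
  rfl

/-- The area formula enters as the hypothesis `hA`, here and below: it is proved for `C¹` functions
and later for sums of disjoint families, not for all Lipschitz functions. -/
lemma graphVarifold_weight (hA : ∀ B, MeasurableSet B →
      (Measure.euclideanHausdorffMeasure 2 : Measure (E 3)) (graphMap f '' B) = graphDensity f B) :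
    (graphVarifold f hf).weight =
      (Measure.euclideanHausdorffMeasure 2 : Measure (E 3)).restrict (range (graphMap f)) := by
  rw [graphVarifold_weight_eq_map]
  ext s hs
  have hF := continuous_graphMap hf.continuous
  rw [Measure.map_apply hF.measurable hs, ← hA _ (hF.measurable hs), image_preimage_eq_inter_range,
    Measure.restrict_apply hs]

/-- The graph with multiplicity one suffices. As `f` is differentiable everywhere, the approximate
tangent plane is given by the gradient at every point of the graph, with no exceptional null set. -/
lemma isIntegral_graphVarifold (hA : ∀ B, MeasurableSet B →
      (Measure.euclideanHausdorffMeasure 2 : Measure (E 3)) (graphMap f '' B) = graphDensity f B)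
    (hd : Differentiable ℝ f) : (graphVarifold f hf).IsIntegral := by
  have hF := isClosedEmbedding_graphMap hf.continuous
  refine ⟨fun i => if i = 0 then range (graphMap f) else ∅, fun i => ?_, fun A hAm => ?_⟩
  · dsimp only
    split_ifs
    · refine ⟨hF.isClosed_range.measurableSet, fun C hC => ?_,
        fun _ => graphMap f, fun _ => ⟨_, lipschitzWith_graphMap hf⟩, ?_⟩
      · rw [inter_comm, ← image_preimage_eq_inter_range, hA _ (hF.continuous.measurable
          hC.measurableSet)]
        refine (graphDensity_le hf _).trans_lt ?_
        rw [Measure.smul_apply, smul_eq_mul]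
        exact ENNReal.mul_lt_top ENNReal.ofReal_lt_top
          (hF.isCompact_preimage hC).measure_lt_top
      · rw [iUnion_const, sdiff_self, measure_empty]
    · exact ⟨MeasurableSet.empty, by simp, fun _ _ => 0, fun _ => ⟨0, LipschitzWith.const _⟩,
        by simp⟩
  · rw [tsum_eq_single 0]
    · have hset : {z | z ∈ range (graphMap f) ∧ ∃ S : Gr 3 2, approxTangentCone 2
          ((Measure.euclideanHausdorffMeasure 2).restrict (range (graphMap f))) z =
          (S.1 : Set (E 3)) ∧ (z, S) ∈ A} = graphMap f '' (gaussMap f ⁻¹' A) := by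
        ext z
        constructor
        · rintro ⟨⟨x, rfl⟩, S, hS, hSA⟩
          rw [approxTangentCone_graph hf (hd x).hasGradientAt] at hS
          have : tangentPlane (gradient f x) = S := Subtype.ext (SetLike.coe_injective hS)
          refine ⟨x, ?_, rfl⟩
          rw [mem_preimage, gaussMap, this]
          exact hSA
        · rintro ⟨x, hx, rfl⟩
          exact ⟨mem_range_self x, tangentPlane (gradient f x),
            approxTangentCone_graph hf (hd x).hasGradientAt, hx⟩
      dsimp only
      rw [if_pos rfl, rectifiableValue, hset, hA _ (measurable_gaussMap hf.continuous hAm)]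
      exact Measure.map_apply (measurable_gaussMap hf.continuous) hAm
    · intro i hi
      simp [rectifiableValue, hi]

lemma approxTangentCone_graphVarifold (hA : ∀ B, MeasurableSet B →
      (Measure.euclideanHausdorffMeasure 2 : Measure (E 3)) (graphMap f '' B) = graphDensity f B)
    {x : E 2} (hd : DifferentiableAt ℝ f x) :
    approxTangentCone 2 (graphVarifold f hf).weight (graphMap f x) =
      (tangentPlane (gradient f x)).1 := by
  rw [graphVarifold_weight hf hA, approxTangentCone_graph hf hd.hasGradientAt]

lemma tangentProj_graphVarifold (hA : ∀ B, MeasurableSet B →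
      (Measure.euclideanHausdorffMeasure 2 : Measure (E 3)) (graphMap f '' B) = graphDensity f B)
    {x : E 2} (hd : DifferentiableAt ℝ f x) :
    tangentProj 2 (graphVarifold f hf).weight (graphMap f x) =
      (tangentPlane (gradient f x)).proj := by
  have h := approxTangentCone_graphVarifold hf hA hd
  have hex : ∃ S : Gr 3 2, approxTangentCone 2 (graphVarifold f hf).weight (graphMap f x) =
      (S.1 : Set (E 3)) := ⟨_, h⟩
  rw [tangentProj, dif_pos hex]
  have := hex.choose_spec
  exact congrArg Gr.proj (Subtype.ext (SetLike.coe_injective (this.symm.trans h)))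

lemma continuous_trace : Continuous fun L : E 3 →L[ℝ] E 3 =>
    LinearMap.trace ℝ (E 3) L.toLinearMap := by
  have : (fun L : E 3 →L[ℝ] E 3 => LinearMap.trace ℝ (E 3) L.toLinearMap) =
      (LinearMap.trace ℝ (E 3)).comp (ContinuousLinearMap.coeLM ℝ) := rfl
  rw [this]
  exact LinearMap.continuous_of_finiteDimensional _

lemma firstVariation_graphVarifold {θ : E 3 → E 3} (hθ : ContDiff ℝ 1 θ) :
    (graphVarifold f hf).firstVariation θ = ∫ x, variationIntegrand f θ x := by
  have hm : Measurable fun p : E 3 × Gr 3 2 => LinearMap.trace ℝ (E 3)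
      (p.2.proj.comp (fderiv ℝ θ p.1)).toLinearMap := by
    refine (continuous_trace.comp ?_).measurable
    exact (continuous_proj.comp continuous_snd).clm_comp
      ((hθ.continuous_fderiv one_ne_zero).comp continuous_fst)
  rw [Varifold.firstVariation, graphVarifold, integral_map
    (measurable_gaussMap hf.continuous).aemeasurable hm.aestronglyMeasurable, graphDensity]
  have hW : Measurable fun x => (areaFactor (gradient f x)).toNNReal :=
    (continuous_areaFactor.measurable.comp (measurable_gradient f)).real_toNNReal
  refine (integral_withDensity_eq_integral_smul hW _).trans ?_
  refine integral_congr_ae (Eventually.of_forall fun x => ?_)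
  simp only [NNReal.smul_def, Real.coe_toNNReal _ (areaFactor_pos _).le, smul_eq_mul]
  rfl

end

/-- The gradient is merely measurable, but it stays in a closed ball. The integrand is a continuous
function `N` of gradient and position, bounded on a compact set and zero off the support of the
derivative of `θ` along the graph. -/
lemma integrable_variationIntegrand {f : E 2 → ℝ} {K : ℝ≥0} (hf : LipschitzWith K f) {θ : E 3 → E 3} (hθ : ContDiff ℝ 1 θ)
    (hc : HasCompactSupport θ) : Integrable (variationIntegrand f θ) := by
  set N : E 2 × E 2 → ℝ := fun p => areaFactor p.1 * LinearMap.trace ℝ (E 3)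
    ((tangentPlane p.1).proj.comp (fderiv ℝ θ (graphMap f p.2))).toLinearMap with hN
  have hNc : Continuous N := by
    refine (continuous_areaFactor.comp continuous_fst).mul (continuous_trace.comp ?_)
    exact (continuous_proj.comp (continuous_tangentPlane.comp continuous_fst)).clm_comp
      ((hθ.continuous_fderiv one_ne_zero).comp
        ((continuous_graphMap hf.continuous).comp continuous_snd))
  have hS : HasCompactSupport fun x => fderiv ℝ θ (graphMap f x) :=
    hc.fderiv (𝕜 := ℝ) |>.comp_isClosedEmbedding (isClosedEmbedding_graphMap hf.continuous)
  set S := tsupport fun x => fderiv ℝ θ (graphMap f x) with hSdef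
  have hScomp : IsCompact S := hS
  obtain ⟨C, hC⟩ := ((isCompact_closedBall (0 : E 2) (K : ℝ)).prod
    hScomp).exists_bound_of_continuousOn hNc.continuousOn
  have hNeq : variationIntegrand f θ = N ∘ fun x => (gradient f x, x) := rfl
  have hm : Measurable (variationIntegrand f θ) := by
    rw [hNeq]
    exact hNc.measurable.comp ((measurable_gradient f).prodMk measurable_id)
  have hsub : Function.support (variationIntegrand f θ) ⊆ S := by
    intro x hx
    by_contra hxS
    refine hx ?_
    rw [variationIntegrand, image_eq_zero_of_notMem_tsupport hxS]
    simp
  rw [← integrableOn_iff_integrable_of_support_subset hsub]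
  refine Measure.integrableOn_of_bounded (M := C) hScomp.measure_lt_top.ne
    hm.aestronglyMeasurable ?_
  filter_upwards [ae_restrict_mem hScomp.measurableSet] with x hx
  rw [hNeq]
  refine hC (gradient f x, x) (mk_mem_prod ?_ hx)
  simpa using norm_gradient_le hf x

/-! ### Sums of functions with disjoint supports -/

lemma gradient_eq_zero_of_notMem_tsupport {u : E 2 → ℝ} {x : E 2} (hx : x ∉ tsupport u) :
    gradient u x = 0 := by
  have h : u =ᶠ[𝓝 x] fun _ => 0 := notMem_tsupport_iff_eventuallyEq.1 hx
  rw [h.gradient_eq, gradient_fun_const]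

lemma meanCurvature_eq_zero_of_notMem_tsupport {u : E 2 → ℝ} {x : E 2} (hx : x ∉ tsupport u) :
    meanCurvature u x = 0 := by
  have h : ∀ᶠ y in 𝓝 x, gradient u y = 0 := by
    filter_upwards [(isClosed_tsupport u).isOpen_compl.mem_nhds hx] with y hy
    exact gradient_eq_zero_of_notMem_tsupport hy
  have h' : ∀ i, (fun y => gradient u y i / areaFactor (gradient u y)) =ᶠ[𝓝 x] fun _ => 0 := by
    intro i
    filter_upwards [h] with y hy
    simp [hy]
  rw [meanCurvature, (h' 0).fderiv_eq, (h' 1).fderiv_eq]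
  simp

/-- A countable family of functions on the plane supported in disjoint open sets, with small
Lipschitz constants and summable total mean curvature. -/
structure DisjointFamily (ι : Type) where
  /-- the functions -/
  u : ι → E 2 → ℝ
  /-- the open sets containing their supports -/
  O : ι → Set (E 2)
  /-- their Lipschitz constants -/
  δ : ι → ℝ≥0
  /-- a common Lipschitz constant -/
  D : ℝ≥0
  isOpen : ∀ k, IsOpen (O k)
  contDiff : ∀ k, ContDiff ℝ 2 (u k)
  tsupport_subset : ∀ k, tsupport (u k) ⊆ O k
  disjoint : Pairwise (Function.onFun Disjoint O)
  lipschitz : ∀ k, LipschitzWith (δ k) (u k)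
  δ_le : ∀ k, δ k ≤ D
  tendsto : Tendsto δ cofinite (𝓝 0)
  curvature : ∑' k, ∫⁻ x, ENNReal.ofReal |meanCurvature (u k) x| < ∞

namespace DisjointFamily

variable {ι : Type} (F : DisjointFamily ι)

/-- The sum of the family. -/
def sum (x : E 2) : ℝ := ∑' k, F.u k x

lemma u_eq_zero {k : ι} {x : E 2} (hx : x ∉ F.O k) : F.u k x = 0 :=
  image_eq_zero_of_notMem_tsupport fun h => hx (F.tsupport_subset k h)

lemma notMem_of_mem {k l : ι} {x : E 2} (hx : x ∈ F.O k) (hl : l ≠ k) : x ∉ F.O l :=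
  fun h => (F.disjoint hl).le_bot ⟨h, hx⟩

lemma sum_of_mem {k : ι} {x : E 2} (hx : x ∈ F.O k) : F.sum x = F.u k x :=
  tsum_eq_single k fun _ hl => F.u_eq_zero (F.notMem_of_mem hx hl)

lemma sum_of_notMem {x : E 2} (hx : ∀ k, x ∉ F.O k) : F.sum x = 0 := by
  rw [sum]
  simp [fun k => F.u_eq_zero (hx k)]

lemma abs_sub_le (k : ι) (x y : E 2) : |F.u k x - F.u k y| ≤ F.δ k * dist x y := by
  rw [← Real.dist_eq]; exact (F.lipschitz k).dist_le_mul x y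

/-- The factor `2` is needed when the two points lie in different sets: each of the two functions
involved vanishes at the other point and contributes `D * dist x y`. -/
lemma lipschitz_sum : LipschitzWith (2 * F.D) F.sum := by
  refine LipschitzWith.of_dist_le_mul fun x y => ?_
  rw [Real.dist_eq]
  push_cast
  have hle : ∀ k, |F.u k x - F.u k y| ≤ F.D * dist x y := fun k =>
    (F.abs_sub_le k x y).trans (by have := F.δ_le k; gcongr)
  have hD : 0 ≤ F.D * dist x y := by positivity
  by_cases hx : ∃ k, x ∈ F.O k <;> by_cases hy : ∃ l, y ∈ F.O l
  · obtain ⟨k, hk⟩ := hx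
    obtain ⟨l, hl⟩ := hy
    rw [F.sum_of_mem hk, F.sum_of_mem hl]
    rcases eq_or_ne k l with rfl | hkl
    · linarith [hle k]
    · have h1 := hle k
      have h2 := hle l
      rw [F.u_eq_zero (F.notMem_of_mem hl hkl), sub_zero] at h1
      rw [F.u_eq_zero (F.notMem_of_mem hk hkl.symm), zero_sub, abs_neg] at h2
      have h3 := abs_sub (F.u k x) (F.u l y)
      linarith
  · obtain ⟨k, hk⟩ := hx
    push Not at hy
    rw [F.sum_of_mem hk, F.sum_of_notMem hy, ← F.u_eq_zero (hy k)]
    linarith [hle k]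
  · obtain ⟨l, hl⟩ := hy
    push Not at hx
    rw [F.sum_of_mem hl, F.sum_of_notMem hx, ← F.u_eq_zero (hx l)]
    linarith [hle l]
  · push Not at hx hy
    rw [F.sum_of_notMem hx, F.sum_of_notMem hy]
    simp only [sub_self, abs_zero]
    positivity

lemma sum_eventuallyEq {k : ι} {x : E 2} (hx : x ∈ F.O k) : F.sum =ᶠ[𝓝 x] F.u k := by
  filter_upwards [(F.isOpen k).mem_nhds hx] with y hy using F.sum_of_mem hy

lemma hasGradientAt_of_mem {k : ι} {x : E 2} (hx : x ∈ F.O k) :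
    HasGradientAt F.sum (gradient (F.u k) x) x :=
  ((F.contDiff k).differentiable two_ne_zero x).hasGradientAt.congr_of_eventuallyEq
    (F.sum_eventuallyEq hx)

/-- Given `η`, only finitely many members have Lipschitz constant at least `η`, and they vanish near
`x` because their supports are closed. At a point `y` in any other `O k` the sum equals `u k y - u k
x`, which is at most `η * ‖y - x‖` in absolute value. -/
lemma hasGradientAt_of_notMem {x : E 2} (hx : ∀ k, x ∉ F.O k) : HasGradientAt F.sum 0 x := by
  rw [hasGradientAt_iff_hasFDerivAt, map_zero, hasFDerivAt_iff_isLittleO,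
    Asymptotics.isLittleO_iff]
  intro η hη
  have hfin : {k | ¬ F.δ k < ⟨η, hη.le⟩}.Finite := by
    have := F.tendsto.eventually (gt_mem_nhds (show (0 : ℝ≥0) < ⟨η, hη.le⟩ from hη))
    exact this
  have hev : ∀ᶠ y in 𝓝 x, ∀ k ∈ {k | ¬ F.δ k < ⟨η, hη.le⟩}, y ∉ tsupport (F.u k) := by
    rw [eventually_all_finite hfin]
    intro k _
    exact (isClosed_tsupport _).isOpen_compl.mem_nhds fun h => hx k (F.tsupport_subset k h)
  filter_upwards [hev] with y hy
  rw [F.sum_of_notMem hx]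
  simp only [sub_zero, zero_apply]
  by_cases hyO : ∃ k, y ∈ F.O k
  · obtain ⟨k, hk⟩ := hyO
    rw [F.sum_of_mem hk]
    by_cases hkδ : F.δ k < ⟨η, hη.le⟩
    · have h1 := F.abs_sub_le k y x
      rw [F.u_eq_zero (hx k), sub_zero, dist_eq_norm] at h1
      have h2 : (F.δ k : ℝ) ≤ η := le_of_lt hkδ
      exact h1.trans (by gcongr)
    · rw [image_eq_zero_of_notMem_tsupport (hy k hkδ), norm_zero]
      positivity
  · push Not at hyO
    rw [F.sum_of_notMem hyO, norm_zero]
    positivity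

lemma gradient_of_mem {k : ι} {x : E 2} (hx : x ∈ F.O k) :
    gradient F.sum x = gradient (F.u k) x := (F.hasGradientAt_of_mem hx).gradient

lemma gradient_of_notMem {x : E 2} (hx : ∀ k, x ∉ F.O k) : gradient F.sum x = 0 :=
  (F.hasGradientAt_of_notMem hx).gradient

lemma differentiable_sum : Differentiable ℝ F.sum := by
  intro x
  by_cases hx : ∃ k, x ∈ F.O k
  · obtain ⟨k, hk⟩ := hx
    exact (F.hasGradientAt_of_mem hk).differentiableAt
  · push Not at hx
    exact (F.hasGradientAt_of_notMem hx).differentiableAt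

lemma graphMap_of_mem {k : ι} {x : E 2} (hx : x ∈ F.O k) :
    graphMap F.sum x = graphMap (F.u k) x := by
  simp only [graphMap, F.sum_of_mem hx]

/-- The density of the total variation of the first variation, in the parameter domain. -/
def curvatureDensity (x : E 2) : ℝ≥0∞ :=
  ∑' k, ENNReal.ofReal (|meanCurvature (F.u k) x| * areaFactor (gradient (F.u k) x))

lemma measurable_meanCurvature (u : E 2 → ℝ) : Measurable (meanCurvature u) :=
  (measurable_fderiv_apply_const ℝ _ _).add (measurable_fderiv_apply_const ℝ _ _)

lemma measurable_curvature_term (k : ι) : Measurable fun x =>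
    ENNReal.ofReal (|meanCurvature (F.u k) x| * areaFactor (gradient (F.u k) x)) :=
  ((continuous_abs.measurable.comp (measurable_meanCurvature _)).mul
    (continuous_areaFactor.measurable.comp (measurable_gradient _))).ennreal_ofReal

/-- An upper bound for the total variation of the first variation. -/
def curvatureMeasure : Measure (E 3) :=
  (volume.withDensity F.curvatureDensity).map (graphMap F.sum)

/-- The varifold of the graph of the sum of the family. -/
def varifold : Varifold 3 2 := graphVarifold F.sum F.lipschitz_sum

lemma variationIntegrand_of_mem (θ : E 3 → E 3) {k : ι} {x : E 2} (hx : x ∈ F.O k) :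
    variationIntegrand F.sum θ x = variationIntegrand (F.u k) θ x := by
  rw [variationIntegrand, variationIntegrand, F.gradient_of_mem hx, F.graphMap_of_mem hx]

lemma variationIntegrand_congr {f g : E 2 → ℝ} (θ : E 3 → E 3) {x : E 2} (h : f x = g x)
    (h' : gradient f x = gradient g x) : variationIntegrand f θ x = variationIntegrand g θ x := by
  rw [variationIntegrand, variationIntegrand, h', graphMap, graphMap, h]

lemma curvatureMeasure_absolutelyContinuous : F.curvatureMeasure ≪ F.varifold.weight := by
  rw [varifold, graphVarifold_weight_eq_map, curvatureMeasure]
  refine Measure.AbsolutelyContinuous.map ?_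
    (continuous_graphMap F.lipschitz_sum.continuous).measurable
  exact (withDensity_absolutelyContinuous _ _).trans
    (volume_le_graphDensity F.sum).absolutelyContinuous

/-! ### Area formula and first variation of the sum -/

variable [Countable ι]

/-- On each `O k` the sum is the `C¹` function `u k`. On the remaining set both the sum and its
gradient vanish, so the formula for the zero function applies there. -/
lemma area_formula (B : Set (E 2)) (hB : MeasurableSet B) :
    (Measure.euclideanHausdorffMeasure 2 : Measure (E 3)) (graphMap F.sum '' B) =
      graphDensity F.sum B := by
  have hemb := measurableEmbedding_graphMap F.lipschitz_sum.continuous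
  set μ := (Measure.euclideanHausdorffMeasure 2 : Measure (E 3)).comap (graphMap F.sum) with hμ
  have hμB : ∀ B, μ B =
      (Measure.euclideanHausdorffMeasure 2 : Measure (E 3)) (graphMap F.sum '' B) :=
    fun B => hemb.comap_apply _ _
  rw [← hμB]
  have hOm : ∀ k, MeasurableSet (F.O k) := fun k => (F.isOpen k).measurableSet
  have hUm : MeasurableSet (⋃ k, F.O k) := MeasurableSet.iUnion hOm
  have h1 : ∀ k, μ (B ∩ F.O k) = graphDensity F.sum (B ∩ F.O k) := by
    intro k
    have hm := hB.inter (hOm k)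
    rw [hμB, image_congr fun x hx => F.graphMap_of_mem hx.2,
      euclideanHausdorffMeasure_graphMap_image ((F.contDiff k).of_le one_le_two) hm,
      graphDensity, withDensity_apply _ hm]
    refine setLIntegral_congr_fun hm fun x hx => ?_
    rw [F.gradient_of_mem hx.2]
  have h2 : μ (B \ ⋃ k, F.O k) = graphDensity F.sum (B \ ⋃ k, F.O k) := by
    have hm := hB.diff hUm
    have hn : ∀ x ∈ B \ ⋃ k, F.O k, ∀ k, x ∉ F.O k := fun x hx k hk =>
      hx.2 (mem_iUnion.2 ⟨k, hk⟩)
    have himg : ∀ x ∈ B \ ⋃ k, F.O k, graphMap F.sum x = graphMap (fun _ => 0) x := by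
      intro x hx
      simp only [graphMap, F.sum_of_notMem (hn x hx)]
    rw [hμB, image_congr himg, euclideanHausdorffMeasure_graphMap_image contDiff_const hm,
      graphDensity, withDensity_apply _ hm]
    refine setLIntegral_congr_fun hm fun x hx => ?_
    rw [F.gradient_of_notMem (hn x hx), gradient_fun_const]
  have hdis : Pairwise (Function.onFun Disjoint fun k => B ∩ F.O k) := fun i j hij =>
    (F.disjoint hij).mono inter_subset_right inter_subset_right
  rw [← measure_inter_add_sdiff B hUm, ← measure_inter_add_sdiff (μ := graphDensity F.sum) B hUm, h2,
    inter_iUnion, measure_iUnion hdis fun k => hB.inter (hOm k),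
    measure_iUnion hdis fun k => hB.inter (hOm k)]
  simp_rw [h1]

lemma lintegral_curvatureDensity_lt_top : ∫⁻ x, F.curvatureDensity x < ∞ := by
  unfold curvatureDensity
  rw [lintegral_tsum fun k => (F.measurable_curvature_term k).aemeasurable]
  have h : ∀ k, ∫⁻ x, ENNReal.ofReal (|meanCurvature (F.u k) x| *
      areaFactor (gradient (F.u k) x)) ≤
      ENNReal.ofReal (1 + F.D) * ∫⁻ x, ENNReal.ofReal |meanCurvature (F.u k) x| := by
    intro k
    rw [← lintegral_const_mul' _ _ ENNReal.ofReal_ne_top]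
    refine lintegral_mono fun x => ?_
    rw [← ENNReal.ofReal_mul (by positivity), mul_comm]
    refine ENNReal.ofReal_le_ofReal (mul_le_mul_of_nonneg_right ?_ (abs_nonneg _))
    refine (areaFactor_le _).trans (add_le_add le_rfl ?_)
    exact (norm_gradient_le (F.lipschitz k) x).trans (F.δ_le k)
  refine (ENNReal.tsum_le_tsum h).trans_lt ?_
  rw [ENNReal.tsum_mul_left]
  exact ENNReal.mul_lt_top ENNReal.ofReal_lt_top F.curvature

lemma isFiniteMeasure_curvatureMeasure : IsFiniteMeasure F.curvatureMeasure := by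
  have : IsFiniteMeasure (volume.withDensity F.curvatureDensity) :=
    isFiniteMeasure_withDensity F.lintegral_curvatureDensity_lt_top.ne
  unfold curvatureMeasure
  infer_instance

/-- The horizontal plane is stationary. Subtracting its integrand leaves an integrable function that
vanishes off the disjoint sets `O k`, so the integral splits, and integration by parts is needed
only for the single `C²` functions `u k`. -/
lemma hasSum_firstVariation {θ : E 3 → E 3} (hθ : ContDiff ℝ 1 θ) (hc : HasCompactSupport θ) :
    HasSum (fun k => -∫ x, meanCurvature (F.u k) x *
      inner ℝ (normalVec (gradient (F.u k) x)) (θ (graphMap (F.u k) x)))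
      (F.varifold.firstVariation θ) := by
  have hI := integrable_variationIntegrand F.lipschitz_sum hθ hc
  have hz := integral_variationIntegrand (u := fun _ => 0) contDiff_const hθ hc
  have hz0 : ∫ x, variationIntegrand (fun _ => 0) θ x = 0 := by
    rw [hz.2]
    have : ∀ x, meanCurvature (fun _ => (0 : ℝ)) x = 0 := fun x =>
      meanCurvature_eq_zero_of_notMem_tsupport (by simp [tsupport])
    simp [this]
  set q : E 2 → ℝ := fun x => variationIntegrand F.sum θ x - variationIntegrand (fun _ => 0) θ x
    with hq
  have hqI : Integrable q := hI.sub hz.1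
  have hq0 : ∀ x, x ∉ (⋃ k, F.O k) → q x = 0 := by
    intro x hx
    have hx' : ∀ k, x ∉ F.O k := fun k hk => hx (mem_iUnion.2 ⟨k, hk⟩)
    rw [hq, sub_eq_zero]
    exact variationIntegrand_congr θ (F.sum_of_notMem hx')
      (by rw [F.gradient_of_notMem hx', gradient_fun_const])
  have hsum := hasSum_integral_iUnion (fun k => (F.isOpen k).measurableSet) F.disjoint
    hqI.integrableOn
  rw [setIntegral_eq_integral_of_forall_compl_eq_zero hq0, hq, integral_sub hI hz.1, hz0,
    sub_zero] at hsum
  rw [varifold, firstVariation_graphVarifold _ hθ]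
  suffices hterm : ∀ k, -∫ x, meanCurvature (F.u k) x *
      inner ℝ (normalVec (gradient (F.u k) x)) (θ (graphMap (F.u k) x)) =
      ∫ x in F.O k, (variationIntegrand F.sum θ x - variationIntegrand (fun _ => 0) θ x) by
    simp_rw [hterm]
    exact hsum
  intro k
  have hk := integral_variationIntegrand (F.contDiff k) hθ hc
  rw [← hk.2]
  have hk0 : ∀ x, x ∉ F.O k →
      variationIntegrand (F.u k) θ x - variationIntegrand (fun _ => 0) θ x = 0 := by
    intro x hx
    rw [sub_eq_zero]
    refine variationIntegrand_congr θ (F.u_eq_zero hx) ?_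
    rw [gradient_eq_zero_of_notMem_tsupport fun h => hx (F.tsupport_subset k h),
      gradient_fun_const]
  calc ∫ x, variationIntegrand (F.u k) θ x
      = ∫ x, (variationIntegrand (F.u k) θ x - variationIntegrand (fun _ => 0) θ x) := by
        rw [integral_sub hk.1 hz.1, hz0, sub_zero]
    _ = ∫ x in F.O k, (variationIntegrand (F.u k) θ x - variationIntegrand (fun _ => 0) θ x) :=
        (setIntegral_eq_integral_of_forall_compl_eq_zero hk0).symm
    _ = _ := setIntegral_congr_fun (F.isOpen k).measurableSet fun x hx => by
        simp only [F.variationIntegrand_of_mem θ hx]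

/-- The normal `(-g, 1)` has length `areaFactor g`, which accounts for that factor in
`curvatureDensity`; the field `θ` vanishes at graph points outside `U`. -/
lemma firstVariation_le {θ : E 3 → E 3} (hθ : ContDiff ℝ 1 θ) (hc : HasCompactSupport θ)
    {U : Set (E 3)} (hU : IsOpen U) (hsupp : tsupport θ ⊆ U) (hθ1 : ∀ z, ‖θ z‖ ≤ 1) :
    ENNReal.ofReal (F.varifold.firstVariation θ) ≤ F.curvatureMeasure U := by
  have hF := continuous_graphMap F.lipschitz_sum.continuous
  have hUm : MeasurableSet (graphMap F.sum ⁻¹' U) := hF.measurable hU.measurableSet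
  rw [curvatureMeasure, Measure.map_apply hF.measurable hU.measurableSet, withDensity_apply _ hUm]
  unfold curvatureDensity
  rw [lintegral_tsum fun k => (F.measurable_curvature_term k).aemeasurable]
  rw [← (F.hasSum_firstVariation hθ hc).tsum_eq]
  refine (Real.ofReal_le_enorm _).trans ((enorm_tsum_le_tsum_enorm).trans
    (ENNReal.tsum_le_tsum fun k => ?_))
  rw [enorm_neg]
  refine (enorm_integral_le_lintegral_enorm _).trans ?_
  rw [← lintegral_indicator hUm]
  refine lintegral_mono fun x => ?_
  by_cases hx : x ∈ F.O k
  · by_cases hxU : x ∈ graphMap F.sum ⁻¹' U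
    · rw [indicator_of_mem hxU, ← ofReal_norm, norm_mul, Real.norm_eq_abs]
      refine ENNReal.ofReal_le_ofReal (mul_le_mul_of_nonneg_left ?_ (abs_nonneg _))
      refine (norm_inner_le_norm _ _).trans ?_
      have h1 : ‖normalVec (gradient (F.u k) x)‖ = areaFactor (gradient (F.u k) x) := by
        rw [← sq_eq_sq₀ (norm_nonneg _) (areaFactor_pos _).le, normalVec_norm_sq]
      rw [h1]
      exact mul_le_of_le_one_right (areaFactor_pos _).le (hθ1 _)
    · have : θ (graphMap (F.u k) x) = 0 := by
        rw [← F.graphMap_of_mem hx]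
        exact image_eq_zero_of_notMem_tsupport fun h => hxU (hsupp h)
      simp [this]
  · rw [meanCurvature_eq_zero_of_notMem_tsupport fun h => hx (F.tsupport_subset k h)]
    simp

lemma variationOpen_le {U : Set (E 3)} (hU : IsOpen U) :
    F.varifold.variationOpen U ≤ F.curvatureMeasure U := by
  refine iSup₂_le fun θ hθ => ?_
  exact F.firstVariation_le (hθ.1.of_le (by exact_mod_cast le_top)) hθ.2.1 hU hθ.2.2.1 hθ.2.2.2

lemma variation_univ_lt_top : F.varifold.variation univ < ∞ := by
  have := F.isFiniteMeasure_curvatureMeasure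
  refine lt_of_le_of_lt ?_ (measure_lt_top F.curvatureMeasure univ)
  exact (iInf₂_le univ ⟨isOpen_univ, subset_univ _⟩).trans (F.variationOpen_le isOpen_univ)

/-- The bound by `curvatureMeasure` holds on open sets only, so a null set is first enlarged to an
open set of small curvature measure, by outer regularity. -/
lemma variation_eq_zero {A : Set (E 3)} (hA : F.varifold.weight A = 0) :
    F.varifold.variation A = 0 := by
  have := F.isFiniteMeasure_curvatureMeasure
  have h0 := F.curvatureMeasure_absolutelyContinuous hA
  refine nonpos_iff_eq_zero.1 (le_of_forall_pos_le_add fun η hη => ?_)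
  obtain ⟨U, hAU, hU, hUη⟩ := A.exists_isOpen_lt_add (μ := F.curvatureMeasure)
    (by simp [h0]) hη.ne'
  rw [h0] at hUη
  exact ((iInf₂_le U ⟨hU, hAU⟩).trans (F.variationOpen_le hU)).trans hUη.le

end DisjointFamily

/-! ### Lower bounds for the tilt -/

lemma half_sq_le_hsNormSq {g : E 2} (hg : ‖g‖ ≤ 1) :
    ‖g‖ ^ 2 / 2 ≤ hsNormSq ((tangentPlane g).proj - horizontalPlane.starProjection) := by
  refine le_trans ?_ (le_hsNormSq_tangentPlane_sub g)
  have := norm_nonneg g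
  gcongr
  nlinarith

lemma tangentPlane_zero_proj : (tangentPlane 0).proj = horizontalPlane.starProjection := by
  simp only [Gr.proj, tangentPlane_zero]

namespace DisjointFamily

variable {ι : Type} (F : DisjointFamily ι)

/-- The graph map has Lipschitz constant `1 + 2 * D ≤ 2`, hence the radius `r / 2`. -/
lemma closedBall_subset_preimage (hD : 2 * F.D ≤ 1) (x : E 2) (r : ℝ) :
    Metric.closedBall x (r / 2) ⊆
      graphMap F.sum ⁻¹' Metric.closedBall (graphMap F.sum x) r := by
  intro y hy
  rw [Metric.mem_closedBall] at hy
  have h := (lipschitzWith_graphMap F.lipschitz_sum).dist_le_mul y x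
  have hK : ((1 + 2 * F.D : ℝ≥0) : ℝ) ≤ 2 := by
    have : ((2 * F.D : ℝ≥0) : ℝ) ≤ 1 := by exact_mod_cast hD
    push_cast at this ⊢
    linarith
  have h2 : ((1 + 2 * F.D : ℝ≥0) : ℝ) * dist y x ≤ 2 * dist y x := by gcongr
  rw [mem_preimage, Metric.mem_closedBall]
  linarith

lemma weight_closedBall_le (hD : 2 * F.D ≤ 1) (x : E 2) {r : ℝ} (hr : 0 ≤ r) :
    F.varifold.weight (Metric.closedBall (graphMap F.sum x) r) ≤ ENNReal.ofReal (8 * r ^ 2) := by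
  have hF := continuous_graphMap F.lipschitz_sum.continuous
  rw [varifold, graphVarifold_weight_eq_map,
    Measure.map_apply hF.measurable Metric.isClosed_closedBall.measurableSet]
  have h1 := graphMap_preimage_closedBall_subset F.sum (graphMap F.sum x) r
  rw [baseProj_graphMap] at h1
  refine (measure_mono h1).trans ((graphDensity_le F.lipschitz_sum _).trans ?_)
  rw [Measure.smul_apply, smul_eq_mul, volume_closedBall_two _ hr,
    ← ENNReal.ofReal_mul (by positivity)]
  refine ENNReal.ofReal_le_ofReal ?_
  have : ((2 * F.D : ℝ≥0) : ℝ) ≤ 1 := by exact_mod_cast hD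
  have h4 := Real.pi_le_four
  calc (1 + ((2 * F.D : ℝ≥0) : ℝ)) * (Real.pi * r ^ 2) ≤ 2 * (4 * r ^ 2) := by
        gcongr; linarith
    _ = 8 * r ^ 2 := by ring

/-- The Dirichlet energy of one member of the family bounds the tilt of the graph from below. -/
lemma le_setLIntegral_hsNormSq (hD : 2 * F.D ≤ 1) {x : E 2} {r : ℝ} {k : ι}
    (hk : F.O k ⊆ Metric.closedBall x (r / 2)) :
    ∫⁻ y in F.O k, ENNReal.ofReal (‖gradient (F.u k) y‖ ^ 2 / 2) ≤
      ∫⁻ y in graphMap F.sum ⁻¹' Metric.closedBall (graphMap F.sum x) r, ENNReal.ofReal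
        (hsNormSq ((tangentPlane (gradient F.sum y)).proj - horizontalPlane.starProjection))
        ∂(graphDensity F.sum) := by
  calc ∫⁻ y in F.O k, ENNReal.ofReal (‖gradient (F.u k) y‖ ^ 2 / 2)
      ≤ ∫⁻ y in F.O k, ENNReal.ofReal (hsNormSq ((tangentPlane (gradient F.sum y)).proj -
          horizontalPlane.starProjection)) := by
        refine setLIntegral_mono' (F.isOpen k).measurableSet fun y hy => ?_
        refine ENNReal.ofReal_le_ofReal ?_
        rw [← F.gradient_of_mem hy]
        refine half_sq_le_hsNormSq ((norm_gradient_le F.lipschitz_sum y).trans ?_)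
        exact_mod_cast hD
    _ ≤ _ := lintegral_mono' (Measure.restrict_mono
        (hk.trans (F.closedBall_subset_preimage hD x r)) (volume_le_graphDensity _)) le_rfl

/-- As the tangent plane over `x` is horizontal, the right-hand side is the planar integral of
`setLIntegral_varifold`. One energy bound thus serves both limits superior. -/
lemma setLIntegral_weight (hA : ∀ B, MeasurableSet B →
      (Measure.euclideanHausdorffMeasure 2 : Measure (E 3)) (graphMap F.sum '' B) =
        graphDensity F.sum B) {x : E 2} (hx : ∀ k, x ∉ F.O k) (r : ℝ) :
    ∫⁻ z in Metric.closedBall (graphMap F.sum x) r, ENNReal.ofReal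
        (hsNormSq (tangentProj 2 F.varifold.weight z -
          tangentProj 2 F.varifold.weight (graphMap F.sum x))) ∂F.varifold.weight =
      ∫⁻ y in graphMap F.sum ⁻¹' Metric.closedBall (graphMap F.sum x) r, ENNReal.ofReal
        (hsNormSq ((tangentPlane (gradient F.sum y)).proj - horizontalPlane.starProjection))
        ∂(graphDensity F.sum) := by
  have hemb := measurableEmbedding_graphMap F.lipschitz_sum.continuous
  have htan : ∀ y, tangentProj 2 F.varifold.weight (graphMap F.sum y) =
      (tangentPlane (gradient F.sum y)).proj := fun y =>
    tangentProj_graphVarifold F.lipschitz_sum hA (F.differentiable_sum y)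
  rw [htan x, F.gradient_of_notMem hx, tangentPlane_zero_proj]
  have hmap : ∀ (φ : E 3 → ℝ≥0∞) (s : Set (E 3)), ∫⁻ z in s, φ z ∂F.varifold.weight =
      ∫⁻ y in graphMap F.sum ⁻¹' s, φ (graphMap F.sum y) ∂(graphDensity F.sum) := by
    intro φ s
    rw [varifold, graphVarifold_weight_eq_map, hemb.restrict_map, hemb.lintegral_map]
  rw [hmap]
  simp_rw [htan]

lemma setLIntegral_varifold (z : E 3) (r : ℝ) :
    ∫⁻ p in Metric.closedBall z r ×ˢ univ, ENNReal.ofReal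
        (hsNormSq (p.2.proj - horizontalPlane.starProjection)) ∂F.varifold.measure =
      ∫⁻ y in graphMap F.sum ⁻¹' Metric.closedBall z r, ENNReal.ofReal
        (hsNormSq ((tangentPlane (gradient F.sum y)).proj - horizontalPlane.starProjection))
        ∂(graphDensity F.sum) := by
  have hm : Measurable fun p : E 3 × Gr 3 2 => ENNReal.ofReal
      (hsNormSq (p.2.proj - horizontalPlane.starProjection)) :=
    (continuous_hsNormSq.comp ((continuous_proj.comp continuous_snd).sub
      continuous_const)).measurable.ennreal_ofReal
  have hs : MeasurableSet (Metric.closedBall z r ×ˢ (univ : Set (Gr 3 2))) :=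
    Metric.isClosed_closedBall.measurableSet.prod MeasurableSet.univ
  have hg := measurable_gaussMap F.lipschitz_sum.continuous
  rw [varifold, graphVarifold, setLIntegral_map hs hm hg]
  have : gaussMap F.sum ⁻¹' (Metric.closedBall z r ×ˢ univ) =
      graphMap F.sum ⁻¹' Metric.closedBall z r := by
    ext y
    simp [gaussMap]
  rw [this]
  rfl

lemma measure_prod_univ (z : E 3) (r : ℝ) :
    F.varifold.measure (Metric.closedBall z r ×ˢ univ) =
      F.varifold.weight (Metric.closedBall z r) := by
  rw [Varifold.weight, Measure.map_apply measurable_fst Metric.isClosed_closedBall.measurableSet,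
    prod_univ]

end DisjointFamily

lemma le_super_quadratic_ratio {R w L κ : ℝ} (hR : 0 < R) (hw : 0 < w) (hL : 0 < L)
    {I : ℝ≥0∞} (hI : ENNReal.ofReal (κ * (R ^ 4 * w * L)) ≤ I) :
    ENNReal.ofReal κ ≤ (ENNReal.ofReal w)⁻¹ * (ENNReal.ofReal (R ^ 4))⁻¹ *
      (ENNReal.ofReal L)⁻¹ * I := by
  have hR4 : 0 < R ^ 4 := by positivity
  refine le_trans (le_of_eq ?_) (mul_le_mul' le_rfl hI)
  rw [← ENNReal.ofReal_inv_of_pos hw, ← ENNReal.ofReal_inv_of_pos hR4,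
    ← ENNReal.ofReal_inv_of_pos hL, ← ENNReal.ofReal_mul (by positivity),
    ← ENNReal.ofReal_mul (by positivity), ← ENNReal.ofReal_mul (by positivity)]
  congr 1
  field_simp

/-- Since `w ≤ 1`, the energy bound may be weakened from `w` to `w ^ 2`, whose square root cancels
the factor `w⁻¹`. -/
lemma le_quadratic_ratio {R w L κ : ℝ} (hR : 0 < R) (hw : 0 < w) (hw1 : w ≤ 1) (hL : 0 < L)
    (hκ : 0 < κ) {I v : ℝ≥0∞} (hI : ENNReal.ofReal (κ * (R ^ 4 * w * L)) ≤ I)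
    (hv : v ≤ ENNReal.ofReal (8 * R ^ 2)) :
    ENNReal.ofReal √(κ / 8) ≤ (ENNReal.ofReal R)⁻¹ * ENNReal.ofReal L ^ (-(1 / 2) : ℝ) *
      (ENNReal.ofReal w)⁻¹ * (I / v) ^ (1 / 2 : ℝ) := by
  have h1 : ENNReal.ofReal (κ / 8 * (R ^ 2 * w ^ 2 * L)) ≤ I / v := by
    calc ENNReal.ofReal (κ / 8 * (R ^ 2 * w ^ 2 * L))
        ≤ ENNReal.ofReal (κ * (R ^ 4 * w * L) / (8 * R ^ 2)) := by
          refine ENNReal.ofReal_le_ofReal ?_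
          have : κ * (R ^ 4 * w * L) / (8 * R ^ 2) = κ / 8 * (R ^ 2 * w * L) := by field_simp
          rw [this]
          gcongr
          nlinarith
      _ = ENNReal.ofReal (κ * (R ^ 4 * w * L)) / ENNReal.ofReal (8 * R ^ 2) :=
          ENNReal.ofReal_div_of_pos (by positivity)
      _ ≤ _ := ENNReal.div_le_div hI hv
  refine le_trans (le_of_eq ?_) (mul_le_mul' le_rfl (ENNReal.rpow_le_rpow h1 (by norm_num)))
  rw [← ENNReal.ofReal_inv_of_pos hw, ← ENNReal.ofReal_inv_of_pos hR,
    ENNReal.ofReal_rpow_of_pos hL, ENNReal.ofReal_rpow_of_pos (by positivity),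
    ← ENNReal.ofReal_mul (by positivity), ← ENNReal.ofReal_mul (by positivity),
    ← ENNReal.ofReal_mul (by positivity)]
  congr 1
  rw [Real.rpow_neg hL.le, ← Real.sqrt_eq_rpow, ← Real.sqrt_eq_rpow,
    Real.sqrt_mul (by positivity), Real.sqrt_mul (by positivity), ← mul_pow,
    Real.sqrt_sq (by positivity)]
  have : √L ≠ 0 := (Real.sqrt_pos.2 hL).ne'
  field_simp

namespace DisjointFamily

variable {ι : Type} (F : DisjointFamily ι)

/-- If the family has members with large Dirichlet energy near `x`, then the tilt of its graph
decays slowly. -/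
theorem limsup_pos [Countable ι] (hD : 2 * F.D ≤ 1) {ω : ℝ → ℝ} (hω : IsModulusOfContinuity ω)
    {κ : ℝ} (hκ : 0 < κ) {x : E 2} (hx : ∀ k, x ∉ F.O k)
    (h : ∀ η > 0, ∃ R > 0, R < η ∧ R < 1 ∧ ∃ k, F.O k ⊆ Metric.closedBall x (R / 2) ∧
      ENNReal.ofReal (κ * (R ^ 4 * ω R * Real.log (1 / R))) ≤
        ∫⁻ y in F.O k, ENNReal.ofReal (‖gradient (F.u k) y‖ ^ 2 / 2)) :
    0 < limsup (fun r : ℝ =>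
        (ENNReal.ofReal r)⁻¹ * ENNReal.ofReal (Real.log (1 / r)) ^ (-(1 / 2) : ℝ) *
          (ENNReal.ofReal (ω r))⁻¹ *
          (⨍⁻ p in Metric.closedBall (graphMap F.sum x) r ×ˢ univ,
            ENNReal.ofReal
              (hsNormSq (p.2.proj - horizontalPlane.starProjection))
            ∂F.varifold.measure) ^ (1 / 2 : ℝ)) (𝓝[>] 0) ∧
    0 < limsup (fun r : ℝ =>
        (ENNReal.ofReal (ω r))⁻¹ * (ENNReal.ofReal (r ^ 4))⁻¹ *
          (ENNReal.ofReal (Real.log (1 / r)))⁻¹ *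
          ∫⁻ z in Metric.closedBall (graphMap F.sum x) r,
            ENNReal.ofReal
              (hsNormSq (tangentProj 2 F.varifold.weight z -
                tangentProj 2 F.varifold.weight (graphMap F.sum x)))
            ∂F.varifold.weight) (𝓝[>] 0) := by
  -- A limit superior is bounded below by any value exceeded at arbitrarily small radii, so the
  -- special radii suffice.
  have hfreq : ∃ᶠ R : ℝ in 𝓝[>] 0, 0 < R ∧ 0 < ω R ∧ ω R ≤ 1 ∧ 0 < Real.log (1 / R) ∧
      ENNReal.ofReal (κ * (R ^ 4 * ω R * Real.log (1 / R))) ≤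
        ∫⁻ y in graphMap F.sum ⁻¹' Metric.closedBall (graphMap F.sum x) R, ENNReal.ofReal
        (hsNormSq ((tangentPlane (gradient F.sum y)).proj - horizontalPlane.starProjection))
        ∂(graphDensity F.sum) := by
    rw [(nhdsGT_basis (0 : ℝ)).frequently_iff]
    intro η hη
    obtain ⟨R, hR, hRη, hR1, k, hk, hE⟩ := h η hη
    have hmem : R ∈ Icc (0 : ℝ) 1 := ⟨hR.le, hR1.le⟩
    have hω0 : ω R ≠ 0 := fun h0 => hR.ne' ((hω.eq_zero_iff R hmem).1 h0)
    refine ⟨R, ⟨hR, hRη⟩, hR, lt_of_le_of_ne (hω.mapsTo hmem).1 hω0.symm, (hω.mapsTo hmem).2,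
      Real.log_pos ((one_lt_div hR).2 hR1), hE.trans (F.le_setLIntegral_hsNormSq hD hk)⟩
  constructor
  · refine lt_of_lt_of_le (ENNReal.ofReal_pos.2 (Real.sqrt_pos.2 (by positivity : 0 < κ / 8)))
      (le_limsup_of_frequently_le ?_)
    refine hfreq.mono fun R ⟨hR, hw, hw1, hL, hI⟩ => ?_
    rw [setLAverage_eq, F.setLIntegral_varifold, F.measure_prod_univ]
    exact le_quadratic_ratio hR hw hw1 hL hκ hI (F.weight_closedBall_le hD x hR.le)
  · refine lt_of_lt_of_le (ENNReal.ofReal_pos.2 hκ) (le_limsup_of_frequently_le ?_)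
    refine hfreq.mono fun R ⟨hR, hw, hw1, hL, hI⟩ => ?_
    rw [F.setLIntegral_weight F.area_formula hx]
    exact le_super_quadratic_ratio hR hw hL hI

end DisjointFamily

/-! ### Bumps on a sequence of grids -/

/-- A rapidly increasing sequence of scales adapted to a modulus of continuity `ω`. The grid
belonging to `n` has mesh size `1 / (4 n²)`, and the bumps centred at its points have radius
`1 / n³`. -/
structure Scales (ω : ℝ → ℝ) (D : ℝ≥0) where
  /-- the scales -/
  n : ℕ → ℕ
  le_n : ∀ i, 8 ≤ n i
  omega_le : ∀ i, √(2 * ω (1 / (n i : ℝ) ^ 2)) ≤ D / 2 ^ i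
  area : ∀ i, 400 * Real.pi * 2 ^ i ≤ (n i : ℝ) ^ 2
  growth : ∀ i, n i ^ 3 ≤ n (i + 1)

/-- Every condition on a single `n i` holds for all large integers, since `ω` tends to zero at `0`;
so each `n (i + 1)` can also be taken beyond `n i ^ 3`. -/
lemma exists_scales {ω : ℝ → ℝ} (hω : IsModulusOfContinuity ω) {D : ℝ≥0} (hD : 0 < D) :
    Nonempty (Scales ω D) := by
  have hD' : (0 : ℝ) < D := hD
  have hsq : Tendsto (fun N : ℕ => ((N : ℝ)) ^ 2) atTop atTop :=
    (tendsto_pow_atTop two_ne_zero).comp tendsto_natCast_atTop_atTop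
  have hR : Tendsto (fun N : ℕ => 1 / (N : ℝ) ^ 2) atTop (𝓝[>] 0) := by
    refine tendsto_nhdsWithin_iff.2 ⟨?_, ?_⟩
    · simp_rw [one_div]
      exact hsq.inv_tendsto_atTop
    · filter_upwards [eventually_gt_atTop 0] with N hN
      have : (0 : ℝ) < N := by exact_mod_cast hN
      exact one_div_pos.2 (pow_pos this 2)
  have hlim : Tendsto (fun N : ℕ => √(2 * ω (1 / (N : ℝ) ^ 2))) atTop (𝓝 0) := by
    have h1 := (hω.tendsto_zero.comp hR).const_mul 2
    rw [mul_zero] at h1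
    simpa using h1.sqrt
  have hev : ∀ i m : ℕ, ∃ N, m ≤ N ∧ 8 ≤ N ∧ √(2 * ω (1 / (N : ℝ) ^ 2)) ≤ D / 2 ^ i ∧
      400 * Real.pi * 2 ^ i ≤ (N : ℝ) ^ 2 := by
    intro i m
    have hp : (0 : ℝ) < D / 2 ^ i := by positivity
    obtain ⟨N, h1, h2, h3, h4⟩ := ((eventually_ge_atTop m).and ((eventually_ge_atTop 8).and
      ((hlim.eventually (ge_mem_nhds hp)).and (hsq.eventually_ge_atTop _)))).exists
    exact ⟨N, h1, h2, h3, h4⟩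
  choose g hg using hev
  let n : ℕ → ℕ := fun i => Nat.rec (g 0 0) (fun i k => g (i + 1) (k ^ 3)) i
  have hn : ∀ i, ∃ m, n i = g i m := fun i => by
    cases i with
    | zero => exact ⟨0, rfl⟩
    | succ i => exact ⟨_, rfl⟩
  refine ⟨⟨n, fun i => ?_, fun i => ?_, fun i => ?_, fun i => (hg (i + 1) (n i ^ 3)).1⟩⟩
  all_goals obtain ⟨m, hm⟩ := hn i; rw [hm]
  · exact (hg i m).2.1
  · exact (hg i m).2.2.1
  · exact (hg i m).2.2.2

namespace Scales

variable {ω : ℝ → ℝ} {D : ℝ≥0} (S : Scales ω D)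

/-- The side of the observed balls. -/
def R (i : ℕ) : ℝ := 1 / (S.n i : ℝ) ^ 2

/-- The radius of the bumps. -/
def ρ (i : ℕ) : ℝ := 1 / (S.n i : ℝ) ^ 3

/-- The inner squared radius of the bumps. -/
def a (i : ℕ) : ℝ := 1 / (S.n i : ℝ) ^ 8

/-- The outer squared radius of the catenoidal part of the bumps. -/
def b (i : ℕ) : ℝ := 1 / (4 * (S.n i : ℝ) ^ 6)

/-- The flux of the bumps. -/
def m (i : ℕ) : ℝ := √(ω (S.R i)) / (S.n i : ℝ) ^ 4

/-- The indices of the grid points. -/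
def grid (i : ℕ) : Finset (ℕ × ℕ) :=
  Finset.range (4 * S.n i ^ 2 + 1) ×ˢ Finset.range (4 * S.n i ^ 2 + 1)

/-- The grid points. -/
def center (i : ℕ) (p : ℕ × ℕ) : E 2 :=
  !₂[(p.1 : ℝ) / (4 * (S.n i : ℝ) ^ 2), (p.2 : ℝ) / (4 * (S.n i : ℝ) ^ 2)]

lemma le_n' (i : ℕ) : (8 : ℝ) ≤ S.n i := by exact_mod_cast S.le_n i

lemma n_pos (i : ℕ) : (0 : ℝ) < S.n i := by linarith [S.le_n' i]

lemma R_pos (i : ℕ) : 0 < S.R i := by have := S.n_pos i; unfold R; positivity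

lemma ρ_pos (i : ℕ) : 0 < S.ρ i := by have := S.n_pos i; unfold ρ; positivity

lemma a_pos (i : ℕ) : 0 < S.a i := by have := S.n_pos i; unfold a; positivity

lemma b_pos (i : ℕ) : 0 < S.b i := by have := S.n_pos i; unfold b; positivity

lemma m_nonneg (i : ℕ) : 0 ≤ S.m i := by have := S.n_pos i; unfold m; positivity

lemma R_lt_one (i : ℕ) : S.R i < 1 := by
  rw [R, div_lt_one (by have := S.n_pos i; positivity)]
  nlinarith [S.le_n' i]

lemma R_mem (i : ℕ) : S.R i ∈ Icc (0 : ℝ) 1 := ⟨(S.R_pos i).le, (S.R_lt_one i).le⟩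

lemma eight_mul_ρ_le (i : ℕ) : 8 * S.ρ i ≤ S.R i := by
  have := S.n_pos i
  rw [ρ, R, mul_one_div, div_le_div_iff₀ (by positivity) (by positivity)]
  nlinarith [S.le_n' i, pow_pos this 2]

lemma ρ_sq (i : ℕ) : S.ρ i ^ 2 = 4 * S.b i := by
  have := S.n_pos i
  rw [ρ, b]; field_simp

lemma n_cube_le {i j : ℕ} (h : j < i) : S.n j ^ 3 ≤ S.n i := by
  have hmono : Monotone S.n := monotone_nat_of_le_succ fun k =>
    (Nat.le_self_pow (by norm_num) _).trans (S.growth k)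
  exact (S.growth j).trans (hmono h)

/-- This is the purpose of the cubic growth: a ball of radius `R i / 2` centred off the doubled
disks of level `j` cannot reach the disks themselves. -/
lemma R_le_ρ {i j : ℕ} (h : j < i) : S.R i ≤ S.ρ j := by
  have h1 : ((S.n j : ℝ)) ^ 3 ≤ S.n i := by exact_mod_cast S.n_cube_le h
  have h2 := S.le_n' i
  have h3 := S.n_pos j
  rw [R, ρ]
  refine one_div_le_one_div_of_le (by positivity) ?_
  nlinarith

lemma exists_R_lt {η : ℝ} (hη : 0 < η) : ∃ i, S.R i < η := by
  obtain ⟨i, hi⟩ := exists_pow_lt_of_lt_one hη (show (1 / 2 : ℝ) < 1 by norm_num)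
  refine ⟨i, lt_of_le_of_lt ?_ hi⟩
  rw [R, one_div_pow]
  refine one_div_le_one_div_of_le (by positivity) (le_trans ?_ (S.area i))
  have : (0 : ℝ) < 2 ^ i := by positivity
  nlinarith [Real.pi_gt_three]

lemma m_sq (hω : IsModulusOfContinuity ω) (i : ℕ) : S.m i ^ 2 = S.R i ^ 4 * ω (S.R i) := by
  have := S.n_pos i
  have h : S.R i ^ 4 = 1 / ((S.n i : ℝ) ^ 4) ^ 2 := by rw [R]; field_simp
  rw [m, div_pow, Real.sq_sqrt (hω.mapsTo (S.R_mem i)).1, h]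
  ring

/-- With `a = R ^ 4` the bound `2 * m ^ 2 / a` on the squared slope no longer contains a power of
`R`; its smallness comes from `ω` alone. -/
lemma two_mul_m_sq_div (hω : IsModulusOfContinuity ω) (i : ℕ) :
    2 * S.m i ^ 2 / S.a i = 2 * ω (S.R i) := by
  have := S.n_pos i
  rw [S.m_sq hω, a, R]
  field_simp

lemma sqrt_omega_le (i : ℕ) : √(2 * ω (S.R i)) ≤ D / 2 ^ i := S.omega_le i

lemma four_mul_m_sq_le (hω : IsModulusOfContinuity ω) (hD : 2 * D ≤ 1) (i : ℕ) :
    4 * S.m i ^ 2 ≤ S.a i := by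
  have hD' : 2 * (D : ℝ) ≤ 1 := by exact_mod_cast hD
  have h1 : (D : ℝ) / 2 ^ i ≤ 1 / 2 := by
    refine (div_le_self D.2 (one_le_pow₀ one_le_two)).trans ?_
    change (D : ℝ) ≤ 1 / 2
    linarith
  have h2 := (S.sqrt_omega_le i).trans h1
  have h3 : 2 * ω (S.R i) ≤ (1 / 2) ^ 2 := (Real.sqrt_le_left (by norm_num)).1 h2
  have h4 := S.two_mul_m_sq_div hω i
  rw [div_eq_iff (S.a_pos i).ne'] at h4
  nlinarith [S.a_pos i]

/-- The bump centred at the grid point with index `p`. -/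
def gridBump (i : ℕ) (p : ℕ × ℕ) : E 2 → ℝ := bump (S.m i) (S.a i) (S.b i) (S.center i p)

lemma contDiff_gridBump (hω : IsModulusOfContinuity ω) (hD : 2 * D ≤ 1) (i : ℕ) (p : ℕ × ℕ) :
    ContDiff ℝ 2 (S.gridBump i p) :=
  contDiff_bump (S.a_pos i) (S.four_mul_m_sq_le hω hD i) _

lemma tsupport_gridBump_subset (hω : IsModulusOfContinuity ω) (hD : 2 * D ≤ 1) (i : ℕ)
    (p : ℕ × ℕ) : tsupport (S.gridBump i p) ⊆ Metric.ball (S.center i p) (S.ρ i) := by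
  have hb := S.b_pos i
  have h1 : tsupport (S.gridBump i p) ⊆ Metric.closedBall (S.center i p) √(2 * S.b i) := by
    refine closure_minimal (fun x hx => ?_) Metric.isClosed_closedBall
    rw [Metric.mem_closedBall, dist_eq_norm]
    refine Real.le_sqrt_of_sq_le (le_of_not_ge fun h => hx ?_)
    exact bump_eq_zero (S.a_pos i) hb (S.four_mul_m_sq_le hω hD i) h
  refine h1.trans (Metric.closedBall_subset_ball ?_)
  rw [Real.sqrt_lt' (S.ρ_pos i), S.ρ_sq]
  linarith

lemma lipschitzWith_gridBump (hω : IsModulusOfContinuity ω) (hD : 2 * D ≤ 1) (i : ℕ)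
    (p : ℕ × ℕ) : LipschitzWith (D / 2 ^ i) (S.gridBump i p) := by
  have hm := S.four_mul_m_sq_le hω hD i
  refine lipschitzWith_of_nnnorm_fderiv_le (𝕜 := ℝ)
    ((S.contDiff_gridBump hω hD i p).differentiable two_ne_zero) fun x => ?_
  rw [← NNReal.coe_le_coe, coe_nnnorm]
  have h1 : ‖fderiv ℝ (S.gridBump i p) x‖ = ‖gradient (S.gridBump i p) x‖ := by
    rw [gradient, LinearIsometryEquiv.norm_map]
  have h2 := norm_gradient_bump_sq_le (b := S.b i) (S.a_pos i) hm (S.center i p) x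
  rw [S.two_mul_m_sq_div hω] at h2
  rw [h1]
  refine (Real.le_sqrt_of_sq_le h2).trans ((S.sqrt_omega_le i).trans ?_)
  push_cast
  exact le_rfl

lemma card_grid_le (i : ℕ) : ((S.grid i).card : ℝ) ≤ 25 * (S.n i : ℝ) ^ 4 := by
  have := S.le_n' i
  rw [grid, Finset.card_product, Finset.card_range]
  push_cast
  have h : 4 * (S.n i : ℝ) ^ 2 + 1 ≤ 5 * (S.n i : ℝ) ^ 2 := by nlinarith
  calc (4 * (S.n i : ℝ) ^ 2 + 1) * (4 * (S.n i : ℝ) ^ 2 + 1)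
      ≤ (5 * (S.n i : ℝ) ^ 2) * (5 * (S.n i : ℝ) ^ 2) := by gcongr
    _ = 25 * (S.n i : ℝ) ^ 4 := by ring

/-- About `n ^ 4` bumps of flux `√(ω R) / n ^ 4` give `√(ω R)` up to the constant `25`; this makes
the total curvature summable over the levels. -/
lemma card_mul_m_le (hω : IsModulusOfContinuity ω) (i : ℕ) :
    (S.grid i).card * S.m i ≤ 25 * D / 2 ^ i := by
  have hn := S.n_pos i
  have h0 := (hω.mapsTo (S.R_mem i)).1
  have h1 : √(ω (S.R i)) ≤ D / 2 ^ i :=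
    (Real.sqrt_le_sqrt (by linarith)).trans (S.sqrt_omega_le i)
  calc (S.grid i).card * S.m i ≤ 25 * (S.n i : ℝ) ^ 4 * S.m i := by
        have := S.m_nonneg i
        have := S.card_grid_le i
        gcongr
    _ = 25 * √(ω (S.R i)) := by rw [m]; field_simp
    _ ≤ 25 * (D / 2 ^ i) := by gcongr
    _ = _ := by ring

lemma card_mul_area_le (i : ℕ) :
    (S.grid i).card * (Real.pi * (2 * S.ρ i) ^ 2) ≤ 1 / 4 * (1 / 2) ^ i := by
  have hn := S.n_pos i
  calc (S.grid i).card * (Real.pi * (2 * S.ρ i) ^ 2)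
      ≤ 25 * (S.n i : ℝ) ^ 4 * (Real.pi * (2 * S.ρ i) ^ 2) := by
        have := S.card_grid_le i
        have := Real.pi_pos
        gcongr
    _ = 100 * Real.pi / (S.n i : ℝ) ^ 2 := by rw [ρ]; field_simp; norm_num
    _ ≤ 1 / 4 * (1 / 2) ^ i := by
        have h := S.area i
        rw [div_le_iff₀ (by positivity)]
        have h2 : (1 / 2 : ℝ) ^ i * 2 ^ i = 1 := by rw [← mul_pow]; norm_num
        have h3 : (0 : ℝ) < (1 / 2) ^ i := by positivity
        have h4 := mul_le_mul_of_nonneg_left h h3.le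
        have h5 : (1 / 2 : ℝ) ^ i * (400 * Real.pi * 2 ^ i) = 400 * Real.pi := by
          linear_combination 400 * Real.pi * h2
        linarith

lemma le_dist_center (i : ℕ) {p q : ℕ × ℕ} (h : p ≠ q) :
    S.R i / 4 ≤ dist (S.center i p) (S.center i q) := by
  have hn := S.n_pos i
  have key : ∀ k l : ℕ, k ≠ l → S.R i / 4 ≤ |(k : ℝ) / (4 * (S.n i : ℝ) ^ 2) -
      (l : ℝ) / (4 * (S.n i : ℝ) ^ 2)| := by
    intro k l hkl
    have h1 : (1 : ℝ) ≤ |(k : ℝ) - l| := by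
      have : (1 : ℤ) ≤ |(k : ℤ) - l| := Int.one_le_abs (sub_ne_zero.2 (by exact_mod_cast hkl))
      exact_mod_cast this
    rw [← sub_div, abs_div, abs_of_pos (show (0 : ℝ) < 4 * (S.n i : ℝ) ^ 2 by positivity), R,
      div_div, mul_comm _ (4 : ℝ)]
    gcongr
  rw [dist_eq_norm]
  rcases not_and_or.1 (fun h' => h (Prod.ext_iff.2 h')) with h0 | h0
  · exact (key _ _ h0).trans (PiLp.norm_apply_le (S.center i p - S.center i q) 0)
  · exact (key _ _ h0).trans (PiLp.norm_apply_le (S.center i p - S.center i q) 1)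

/-- Rounding down moves each coordinate by at most `R / 4`, and `√2 / 4 < 3 / 8`. The remaining `R /
8` up to `R / 2` leaves room for the disk of radius `ρ ≤ R / 8`. -/
lemma exists_center_near (i : ℕ) {x : E 2} (hx : ∀ k, x k ∈ Icc (0 : ℝ) 1) :
    ∃ p ∈ S.grid i, dist (S.center i p) x ≤ 3 / 8 * S.R i := by
  have hn := S.n_pos i
  have hN : (0 : ℝ) < 4 * (S.n i : ℝ) ^ 2 := by positivity
  have key : ∀ k, ⌊4 * (S.n i : ℝ) ^ 2 * x k⌋₊ < 4 * S.n i ^ 2 + 1 ∧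
      ((⌊4 * (S.n i : ℝ) ^ 2 * x k⌋₊ : ℝ) / (4 * (S.n i : ℝ) ^ 2) - x k) ^ 2 ≤ (S.R i / 4) ^ 2 := by
    intro k
    have h0 : 0 ≤ 4 * (S.n i : ℝ) ^ 2 * x k := mul_nonneg hN.le (hx k).1
    have h1 := Nat.floor_le h0
    have h2 := Nat.lt_floor_add_one (4 * (S.n i : ℝ) ^ 2 * x k)
    constructor
    · rw [Nat.lt_succ_iff]
      have : (⌊4 * (S.n i : ℝ) ^ 2 * x k⌋₊ : ℝ) ≤ 4 * (S.n i : ℝ) ^ 2 :=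
        h1.trans (mul_le_of_le_one_right hN.le (hx k).2)
      exact_mod_cast this
    · have h3 : (⌊4 * (S.n i : ℝ) ^ 2 * x k⌋₊ : ℝ) / (4 * (S.n i : ℝ) ^ 2) - x k =
          (⌊4 * (S.n i : ℝ) ^ 2 * x k⌋₊ - 4 * (S.n i : ℝ) ^ 2 * x k) * (S.R i / 4) := by
        rw [R]; field_simp
      rw [h3, mul_pow]
      refine mul_le_of_le_one_left (sq_nonneg _) ?_
      nlinarith
  refine ⟨(⌊4 * (S.n i : ℝ) ^ 2 * x 0⌋₊, ⌊4 * (S.n i : ℝ) ^ 2 * x 1⌋₊), ?_, ?_⟩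
  · rw [grid, Finset.mem_product, Finset.mem_range, Finset.mem_range]
    exact ⟨(key 0).1, (key 1).1⟩
  · have hR := S.R_pos i
    rw [dist_eq_norm, ← sq_le_sq₀ (norm_nonneg _) (by positivity), norm_sq_two]
    have h0 := (key 0).2
    have h1 := (key 1).2
    simp only [center, PiLp.sub_apply, Matrix.cons_val]
    nlinarith

/-! ### Selection of bumps with disjoint disks -/

/-- A bump is used if its disk does not meet the larger disks. -/
def Active (x : ℕ × (ℕ × ℕ)) : Prop :=
  x.2 ∈ S.grid x.1 ∧ ∀ j < x.1, ∀ q ∈ S.grid j,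
    Disjoint (Metric.ball (S.center x.1 x.2) (S.ρ x.1)) (Metric.ball (S.center j q) (S.ρ j))

/-- The indices of the bumps that are used. -/
abbrev Index : Type := {x : ℕ × (ℕ × ℕ) // S.Active x}

lemma disjoint_ball (k l : S.Index) (h : k ≠ l) :
    Disjoint (Metric.ball (S.center k.1.1 k.1.2) (S.ρ k.1.1))
      (Metric.ball (S.center l.1.1 l.1.2) (S.ρ l.1.1)) := by
  obtain ⟨⟨i, p⟩, hk⟩ := k
  obtain ⟨⟨j, q⟩, hl⟩ := l
  rcases lt_trichotomy i j with hij | rfl | hij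
  · exact (hl.2 i hij p hk.1).symm
  · have hpq : p ≠ q := fun h' => h (by subst h'; rfl)
    refine Metric.ball_disjoint_ball ?_
    have := S.le_dist_center i hpq
    have := S.eight_mul_ρ_le i
    simp only
    linarith
  · exact hk.2 j hij q hl.1

lemma finite_index_lt (N : ℕ) : {k : S.Index | k.1.1 < N}.Finite := by
  have h : {x : ℕ × (ℕ × ℕ) | x.1 < N ∧ x.2 ∈ S.grid x.1}.Finite := by
    refine ((Finset.range N).finite_toSet.biUnion fun i _ =>
      ((S.grid i).finite_toSet.image (Prod.mk i))).subset ?_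
    rintro ⟨i, p⟩ ⟨h1, h2⟩
    exact mem_biUnion (Finset.mem_coe.2 (Finset.mem_range.2 h1)) ⟨p, h2, rfl⟩
  refine (h.preimage Subtype.val_injective.injOn).subset ?_
  intro k hk
  exact ⟨hk, k.2.1⟩

lemma tendsto_lipschitz_constants :
    Tendsto (fun k : S.Index => D / 2 ^ k.1.1) cofinite (𝓝 0) := by
  have h1 : Tendsto (fun k : S.Index => k.1.1) cofinite atTop := by
    rw [tendsto_atTop]
    intro N
    rw [eventually_cofinite]
    simpa using S.finite_index_lt N
  have h2 : Tendsto (fun i : ℕ => D / 2 ^ i) atTop (𝓝 0) := by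
    have := (NNReal.tendsto_pow_atTop_nhds_zero_of_lt_one (r := 1 / 2)
      (by rw [← NNReal.coe_lt_coe]; norm_num)).const_mul D
    rw [mul_zero] at this
    refine this.congr fun i => ?_
    rw [one_div, inv_pow, div_eq_mul_inv]
  exact h2.comp h1

/-- The sum over selected bumps is at most that over all grid points, which is geometric in the
level. -/
lemma tsum_index_le (w : ℕ → ℝ) (φ : S.Index → ℝ≥0∞) (C : ℝ) (hC : 0 ≤ C)
    (hw : ∀ i, (S.grid i).card * w i ≤ C * (1 / 2) ^ i)
    (hφ : ∀ k, φ k ≤ ENNReal.ofReal (w k.1.1)) : ∑' k, φ k ≤ ENNReal.ofReal (2 * C) := by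
  classical
  let W : ℕ × (ℕ × ℕ) → ℝ≥0∞ := fun x =>
    if x.2 ∈ S.grid x.1 then ENNReal.ofReal (w x.1) else 0
  calc ∑' k, φ k ≤ ∑' k : S.Index, W k.1 := by
        refine ENNReal.tsum_le_tsum fun k => (hφ k).trans (le_of_eq ?_)
        simp only [W]
        rw [if_pos k.2.1]
    _ ≤ ∑' x, W x := ENNReal.tsum_comp_le_tsum_of_injective Subtype.val_injective W
    _ = ∑' i, ∑' p, W (i, p) := ENNReal.tsum_prod (f := fun i p => W (i, p))
    _ ≤ ∑' i, ENNReal.ofReal (C * (1 / 2) ^ i) := by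
        refine ENNReal.tsum_le_tsum fun i => ?_
        rw [tsum_eq_sum (s := S.grid i) fun p hp => by simp only [W]; rw [if_neg hp]]
        rw [Finset.sum_congr rfl fun p hp => show W (i, p) = ENNReal.ofReal (w i) by
          simp only [W]; rw [if_pos hp]]
        rw [Finset.sum_const, ← ENNReal.ofReal_nsmul, nsmul_eq_mul]
        exact ENNReal.ofReal_le_ofReal (hw i)
    _ = ENNReal.ofReal (2 * C) := by
        rw [← ENNReal.ofReal_tsum_of_nonneg (fun i => by positivity)
          (summable_geometric_two.mul_left C), tsum_mul_left, tsum_geometric_two, mul_comm]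

/-- The family of all bumps that are used. -/
def family (hω : IsModulusOfContinuity ω) (hD : 2 * D ≤ 1) : DisjointFamily S.Index where
  u k := S.gridBump k.1.1 k.1.2
  O k := Metric.ball (S.center k.1.1 k.1.2) (S.ρ k.1.1)
  δ k := D / 2 ^ k.1.1
  D := D
  isOpen _ := Metric.isOpen_ball
  contDiff _ := S.contDiff_gridBump hω hD _ _
  tsupport_subset _ := S.tsupport_gridBump_subset hω hD _ _
  disjoint k l h := S.disjoint_ball k l h
  lipschitz _ := S.lipschitzWith_gridBump hω hD _ _
  δ_le k := div_le_self zero_le (one_le_pow₀ one_le_two)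
  tendsto := S.tendsto_lipschitz_constants
  curvature := by
    obtain ⟨M, hM0, hM⟩ := exists_lintegral_meanCurvature_bump_le
    refine (S.tsum_index_le (fun i => M * S.m i) _ (M * (25 * D)) (by positivity) (fun i => ?_)
      fun k => hM _ _ _ _ (S.m_nonneg _) (S.a_pos _) (S.b_pos _)
        (S.four_mul_m_sq_le hω hD _)).trans_lt ENNReal.ofReal_lt_top
    have := S.card_mul_m_le hω i
    calc (S.grid i).card * (M * S.m i) = M * ((S.grid i).card * S.m i) := by ring
      _ ≤ M * (25 * D / 2 ^ i) := by gcongr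
      _ = M * (25 * D) * (1 / 2) ^ i := by rw [one_div_pow]; ring

/-! ### Points far from all grid points -/

/-- The set of points in a disk that stay away from all grid points. -/
def farSet : Set (E 2) :=
  Metric.closedBall !₂[1 / 2, 1 / 2] (1 / 2) \
    ⋃ i, ⋃ p ∈ S.grid i, Metric.ball (S.center i p) (2 * S.ρ i)

/-- The doubled disks have total area at most `1 / 2`, less than the area `π / 4` of the big disk.
-/
lemma volume_farSet_pos : 0 < volume S.farSet := by
  have h1 : volume (⋃ i, ⋃ p ∈ S.grid i, Metric.ball (S.center i p) (2 * S.ρ i)) ≤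
      ENNReal.ofReal (1 / 2) := by
    calc volume (⋃ i, ⋃ p ∈ S.grid i, Metric.ball (S.center i p) (2 * S.ρ i))
        ≤ ∑' i, volume (⋃ p ∈ S.grid i, Metric.ball (S.center i p) (2 * S.ρ i)) :=
          measure_iUnion_le _
      _ ≤ ∑' i, ENNReal.ofReal (1 / 4 * (1 / 2) ^ i) := by
          refine ENNReal.tsum_le_tsum fun i => (measure_biUnion_finset_le _ _).trans ?_
          have hρ := S.ρ_pos i
          simp_rw [volume_ball_two _ (show 0 ≤ 2 * S.ρ i by positivity)]
          rw [Finset.sum_const, ← ENNReal.ofReal_nsmul, nsmul_eq_mul]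
          exact ENNReal.ofReal_le_ofReal (S.card_mul_area_le i)
      _ = ENNReal.ofReal (1 / 2) := by
          rw [← ENNReal.ofReal_tsum_of_nonneg (fun i => by positivity)
            (summable_geometric_two.mul_left _), tsum_mul_left, tsum_geometric_two]
          norm_num
  have h2 : ENNReal.ofReal (1 / 2) <
      volume (Metric.closedBall (!₂[1 / 2, 1 / 2] : E 2) (1 / 2)) := by
    rw [volume_closedBall_two _ (by norm_num)]
    refine (ENNReal.ofReal_lt_ofReal_iff (by positivity)).2 ?_
    nlinarith [Real.pi_gt_three]
  refine lt_of_lt_of_le ?_ le_measure_sdiff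
  rw [tsub_pos_iff_lt]
  exact h1.trans_lt h2

lemma coord_mem_of_mem_farSet {x : E 2} (hx : x ∈ S.farSet) (k : Fin 2) :
    x k ∈ Icc (0 : ℝ) 1 := by
  have h1 := hx.1
  rw [Metric.mem_closedBall, dist_eq_norm] at h1
  have h2 := (PiLp.norm_apply_le (x - !₂[1 / 2, 1 / 2]) k).trans h1
  have h3 : (x - !₂[1 / 2, 1 / 2] : E 2) k = x k - 1 / 2 := by fin_cases k <;> rfl
  rw [h3, Real.norm_eq_abs, abs_le] at h2
  exact ⟨by linarith, by linarith⟩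

lemma le_dist_of_mem_farSet {x : E 2} (hx : x ∈ S.farSet) {i : ℕ} {p : ℕ × ℕ}
    (hp : p ∈ S.grid i) : 2 * S.ρ i ≤ dist x (S.center i p) := by
  by_contra! h
  exact hx.2 (mem_iUnion.2 ⟨i, mem_iUnion₂.2 ⟨p, hp, h⟩⟩)

lemma ball_subset_closedBall {x : E 2} {i : ℕ} {p : ℕ × ℕ}
    (hp : dist (S.center i p) x ≤ 3 / 8 * S.R i) :
    Metric.ball (S.center i p) (S.ρ i) ⊆ Metric.closedBall x (S.R i / 2) := by
  refine Metric.ball_subset_closedBall.trans (Metric.closedBall_subset_closedBall' ?_)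
  linarith [S.eight_mul_ρ_le i]

/-- The disk of the bump lies within `R i / 2 ≤ ρ j / 2` of `x`, whereas `x` has distance at least
`2 * ρ j` from the centres of every coarser level `j`. -/
lemma active_of_near {x : E 2} (hx : x ∈ S.farSet) {i : ℕ} {p : ℕ × ℕ} (hp : p ∈ S.grid i)
    (hpx : dist (S.center i p) x ≤ 3 / 8 * S.R i) : S.Active (i, p) := by
  refine ⟨hp, fun j hj q hq => ?_⟩
  refine (Metric.closedBall_disjoint_ball ?_).mono_left (S.ball_subset_closedBall hpx)
  have h1 := S.le_dist_of_mem_farSet hx hq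
  have h2 := S.R_le_ρ hj
  have h3 := S.R_pos i
  linarith

/-- Here `b / (2 * a) = n ^ 2 / 8 ≥ n` because `n ≥ 8`, and `log n` is half of `log (1 / R)`. The
other factor `1 / 2` is the one in the integrand. -/
lemma energy_gridBump (hω : IsModulusOfContinuity ω) (hD : 2 * D ≤ 1) (i : ℕ) (p : ℕ × ℕ) :
    ENNReal.ofReal (1 / 4 * (S.R i ^ 4 * ω (S.R i) * Real.log (1 / S.R i))) ≤
      ∫⁻ y in Metric.ball (S.center i p) (S.ρ i),
        ENNReal.ofReal (‖gradient (S.gridBump i p) y‖ ^ 2 / 2) := by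
  have hn := S.n_pos i
  have hn8 := S.le_n' i
  have hb := S.b_pos i
  have ha := S.a_pos i
  have hab : S.b i / (2 * S.a i) = (S.n i : ℝ) ^ 2 / 8 := by rw [a, b]; field_simp; norm_num
  have hab' : 2 * S.a i ≤ S.b i := by
    rw [← one_le_div (by positivity), hab]
    nlinarith
  have h1 := le_setLIntegral_norm_gradient_bump (S.center i p) ha hb hab'
    (S.four_mul_m_sq_le hω hD i)
  have hlog : 1 / 2 * Real.log (1 / S.R i) ≤ Real.log (S.b i / (2 * S.a i)) := by
    rw [hab, R, one_div_one_div, Real.log_pow]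
    have : 1 / 2 * (((2 : ℕ) : ℝ) * Real.log (S.n i)) = Real.log (S.n i) := by push_cast; ring
    rw [this]
    refine Real.log_le_log hn ?_
    nlinarith
  have hsub : Metric.closedBall (S.center i p) √(S.b i) ⊆ Metric.ball (S.center i p) (S.ρ i) := by
    refine Metric.closedBall_subset_ball ?_
    rw [Real.sqrt_lt' (S.ρ_pos i), S.ρ_sq]
    linarith
  have hsplit : ∀ y, ENNReal.ofReal (‖gradient (S.gridBump i p) y‖ ^ 2 / 2) =
      ENNReal.ofReal (1 / 2) * ENNReal.ofReal (‖gradient (S.gridBump i p) y‖ ^ 2) := by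
    intro y
    rw [← ENNReal.ofReal_mul (by norm_num)]
    congr 1
    ring
  simp_rw [hsplit]
  rw [lintegral_const_mul' _ _ ENNReal.ofReal_ne_top]
  calc ENNReal.ofReal (1 / 4 * (S.R i ^ 4 * ω (S.R i) * Real.log (1 / S.R i)))
      ≤ ENNReal.ofReal (1 / 2 * (S.m i ^ 2 * Real.log (S.b i / (2 * S.a i)))) := by
        refine ENNReal.ofReal_le_ofReal ?_
        rw [← S.m_sq hω]
        nlinarith [sq_nonneg (S.m i)]
    _ = ENNReal.ofReal (1 / 2) * ENNReal.ofReal (S.m i ^ 2 * Real.log (S.b i / (2 * S.a i))) :=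
        ENNReal.ofReal_mul (by norm_num)
    _ ≤ _ := mul_le_mul' le_rfl (h1.trans (lintegral_mono_set hsub))

lemma notMem_of_mem_farSet (hω : IsModulusOfContinuity ω) (hD : 2 * D ≤ 1) {x : E 2}
    (hx : x ∈ S.farSet) (k : S.Index) : x ∉ (S.family hω hD).O k := by
  intro h
  have h1 := S.le_dist_of_mem_farSet hx k.2.1
  have h2 : dist x (S.center k.1.1 k.1.2) < S.ρ k.1.1 := h
  linarith [S.ρ_pos k.1.1]

lemma exists_large_energy (hω : IsModulusOfContinuity ω) (hD : 2 * D ≤ 1) {x : E 2}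
    (hx : x ∈ S.farSet) (η : ℝ) (hη : 0 < η) :
    ∃ R > 0, R < η ∧ R < 1 ∧ ∃ k, (S.family hω hD).O k ⊆ Metric.closedBall x (R / 2) ∧
      ENNReal.ofReal (1 / 4 * (R ^ 4 * ω R * Real.log (1 / R))) ≤
        ∫⁻ y in (S.family hω hD).O k,
          ENNReal.ofReal (‖gradient ((S.family hω hD).u k) y‖ ^ 2 / 2) := by
  obtain ⟨i, hi⟩ := S.exists_R_lt hη
  obtain ⟨p, hp, hpx⟩ := S.exists_center_near i (S.coord_mem_of_mem_farSet hx)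
  exact ⟨S.R i, S.R_pos i, hi, S.R_lt_one i, ⟨(i, p), S.active_of_near hx hp hpx⟩,
    S.ball_subset_closedBall hpx, S.energy_gridBump hω hD i p⟩

end Scales

end GMT

end

/-! ### Conclusion -/

theorem theoremB (ω : ℝ → ℝ) (hω : GMT.IsModulusOfContinuity ω) (ε : ℝ) (hε : 0 < ε) :
    ∃ (f : GMT.E 2 → ℝ) (V : GMT.Varifold 3 2) (C : Set (GMT.E 3)),
      LipschitzWith ε.toNNReal f ∧
      V.IsIntegral ∧
      V.weight = (Measure.euclideanHausdorffMeasure 2).restrict (range (GMT.graphMap f)) ∧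
      V.variation univ < ∞ ∧
      (∀ A : Set (GMT.E 3), V.weight A = 0 → V.variation A = 0) ∧
      C ⊆ (GMT.horizontalPlane : Set (GMT.E 3)) ∧
      0 < V.weight C ∧
      ∀ c ∈ C,
        GMT.approxTangentCone 2 V.weight c = (GMT.horizontalPlane : Set (GMT.E 3)) ∧
        0 < limsup (fun r : ℝ =>
            (ENNReal.ofReal r)⁻¹ * ENNReal.ofReal (Real.log (1 / r)) ^ (-(1 / 2) : ℝ) *
              (ENNReal.ofReal (ω r))⁻¹ *
              (⨍⁻ p in Metric.closedBall c r ×ˢ univ,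
                ENNReal.ofReal
                  (GMT.hsNormSq (p.2.proj - GMT.horizontalPlane.starProjection))
                ∂V.measure) ^ (1 / 2 : ℝ)) (𝓝[>] 0) ∧
        0 < limsup (fun r : ℝ =>
            (ENNReal.ofReal (ω r))⁻¹ * (ENNReal.ofReal (r ^ 4))⁻¹ *
              (ENNReal.ofReal (Real.log (1 / r)))⁻¹ *
              ∫⁻ z in Metric.closedBall c r,
                ENNReal.ofReal
                  (GMT.hsNormSq (GMT.tangentProj 2 V.weight z - GMT.tangentProj 2 V.weight c))
                ∂V.weight) (𝓝[>] 0) := by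
  -- The sum has Lipschitz constant `2 * D`. It must not exceed `ε`, nor `1`, which the tilt
  -- estimates require.
  set D : ℝ≥0 := min 1 ε.toNNReal / 2 with hDdef
  have hε' : 0 < ε.toNNReal := Real.toNNReal_pos.2 hε
  have hD0 : 0 < D := half_pos (lt_min one_pos hε')
  have hD2 : 2 * D = min 1 ε.toNNReal := mul_div_cancel₀ _ two_ne_zero
  have hD : 2 * D ≤ 1 := hD2.trans_le (min_le_left _ _)
  obtain ⟨S⟩ := GMT.exists_scales hω hD0
  set F := S.family hω hD with hF
  have hfar : ∀ x ∈ S.farSet, ∀ k, x ∉ F.O k := fun x hx => S.notMem_of_mem_farSet hω hD hx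
  refine ⟨F.sum, F.varifold, GMT.graphMap F.sum '' S.farSet,
    F.lipschitz_sum.weaken (hD2.trans_le (min_le_right _ _)),
    GMT.isIntegral_graphVarifold F.lipschitz_sum F.area_formula F.differentiable_sum,
    GMT.graphVarifold_weight F.lipschitz_sum F.area_formula, F.variation_univ_lt_top,
    fun A hA => F.variation_eq_zero hA, ?_, ?_, ?_⟩
  · rintro _ ⟨x, hx, rfl⟩
    exact F.sum_of_notMem (hfar x hx)
  · have hemb := GMT.measurableEmbedding_graphMap F.lipschitz_sum.continuous
    rw [GMT.DisjointFamily.varifold, GMT.graphVarifold_weight_eq_map, hemb.map_apply,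
      preimage_image_eq _ (GMT.injective_graphMap _)]
    exact S.volume_farSet_pos.trans_le (GMT.volume_le_graphDensity _ _)
  · rintro _ ⟨x, hx, rfl⟩
    refine ⟨?_, F.limsup_pos hD hω (by norm_num : (0 : ℝ) < 1 / 4) (hfar x hx)
      (S.exists_large_energy hω hD hx)⟩
    rw [GMT.DisjointFamily.varifold, GMT.approxTangentCone_graphVarifold F.lipschitz_sum
      F.area_formula (F.differentiable_sum x), F.gradient_of_notMem (hfar x hx),
      GMT.tangentPlane_zero]
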